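/- All simplicial complexes have finite simplices. A simplicial complex $X$ is \emph{flag} if every finite nonempty set of vertices of $X$ that are pairwise joined by edges is a simplex of $X$. The \emph{link} $X_\sigma$ of a simplex $\sigma$ is the subcomplex of all simplices $\tau$ of $X$ with $\tau\cap\sigma=\emptyset$ and $\tau\cup\sigma\in X$. For $k\ge 4$, a flag complex is \emph{$k$-large} if every cycle (of length at least $4$) that is a full subcomplex has length at least $k$; a flag complex is \emph{locally $k$-large} if all links of its simplices are $k$-large. A \emph{systolic} complex is a connected and simply connected, locally $6$-large flag simplicial complex. Let $d$ be the path metric on the vertices of the $1$-skeleton of $X$, and let $B_i(v)$ and $S_i(v)$ be the full subcomplexes of $X$ spanned by the vertices at distance at most $i$, respectively exactly $i$, from the vertex $v$. The complex $X$ has property $\widetilde{SD}_n(v)$ if for every $i=1,\dots,n$: (E) for every edge $e$ of $S_{i+1}(v)$ the intersection $X_e\cap B_i(v)$ is nonempty; and (V) for every vertex $w$ of $S_{i+1}(v)$ the intersection $X_w\cap B_i(v)$ is a single (nonempty, finite) simplex. A connected flag complex $X$ is \emph{weakly systolic} if it has property $\widetilde{SD}_n(v)$ for all natural numbers $n$ and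 all vertices $v$. A group is \emph{systolic} (respectively \emph{weakly systolic}) if it acts geometrically, i.e. properly discontinuously and cocompactly by simplicial automorphisms, on a systolic (respectively weakly systolic) complex. Then: (1) every systolic complex whose $1$-skeleton contains no infinite clique is weakly systolic; (2) every systolic group is weakly systolic; (3) every finite-dimensional systolic complex is contractible. -/

import Mathlib

universe u v

noncomputable section

/-! Throughout, a simplicial complex with vertices in a type `V` is Mathlib's
`PreAbstractSimplicialComplex V`: a family of nonempty finite subsets of `V` (the simplices), closed
under passing to nonempty subsets.  Its vertices are those `w : V` for which `{w}` is a simplex. -/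

namespace PreAbstractSimplicialComplex

section Realization

variable {V : Type v}

/-- The geometric realization of `X`: systems of barycentric coordinates whose support is a simplex
of `X`. -/
def Realization (X : PreAbstractSimplicialComplex V) : Type v :=
  {p : V →₀ ℝ // p.support ∈ X.faces ∧ (∀ w, 0 ≤ p w) ∧ p.sum (fun _ t => t) = 1}

/-- The closed geometric simplex of the realization that is spanned by `σ`. -/
def closedSimplex (X : PreAbstractSimplicialComplex V) (σ : Finset V) : Set X.Realization :=
  {p | p.1.support ⊆ σ}

/-- The weak (coherent) topology: a set is open if and only if its intersection with each closed
simplex is open in that simplex, where closed simplices carry the Euclidean topology. -/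
instance (X : PreAbstractSimplicialComplex V) : TopologicalSpace X.Realization :=
  ⨆ σ : X.faces,
    TopologicalSpace.coinduced (fun p : X.closedSimplex (σ : Finset V) => (p : X.Realization))
      (TopologicalSpace.induced
        (fun (p : X.closedSimplex (σ : Finset V)) (w : V) => (p : X.Realization).1 w)
        inferInstance)

end Realization

section Basic

variable {V : Type v} (X : PreAbstractSimplicialComplex V)

open Classical in
/-- The `1`-skeleton as a graph.  Distances between vertices are distances in this graph. -/
def oneSkeleton : SimpleGraph V where
  Adj a b := a ≠ b ∧ {a, b} ∈ X.faces
  symm := ⟨fun a b h => ⟨h.1.symm, by rw [Finset.pair_comm]; exact h.2⟩⟩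
  loopless := ⟨fun _ h => h.1 rfl⟩

/-- `X` is flag: every finite nonempty set of vertices of `X` that are pairwise joined by edges is a
simplex. -/
def IsFlag : Prop :=
  ∀ σ : Finset V, σ.Nonempty → (∀ a ∈ σ, {a} ∈ X.faces) →
    (∀ a ∈ σ, ∀ b ∈ σ, a ≠ b → X.oneSkeleton.Adj a b) → σ ∈ X.faces

/-- The full subcomplex spanned by the vertices of `X` lying in `S`. -/
def span (S : Set V) : PreAbstractSimplicialComplex V where
  faces := {σ | σ ∈ X.faces ∧ (σ : Set V) ⊆ S}
  isRelLowerSet_faces := fun _ hσ =>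
    ⟨(X.isRelLowerSet_faces hσ.1).1, fun _ hτ hne =>
      ⟨(X.isRelLowerSet_faces hσ.1).2 hτ hne, fun _ ha => hσ.2 (hτ ha)⟩⟩

open Classical in
/-- The link of `σ` in `X`. -/
def link (σ : Finset V) : PreAbstractSimplicialComplex V where
  faces := {τ | τ ∈ X.faces ∧ Disjoint τ σ ∧ τ ∪ σ ∈ X.faces}
  isRelLowerSet_faces := fun _ hτ =>
    ⟨(X.isRelLowerSet_faces hτ.1).1, fun _ hρ hne =>
      ⟨(X.isRelLowerSet_faces hτ.1).2 hρ hne, hτ.2.1.mono_left hρ,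
        (X.isRelLowerSet_faces hτ.2.2).2 (Finset.union_subset_union_left hρ)
          (hne.mono Finset.subset_union_left)⟩⟩

/-- The combinatorial ball `B_i(x)` around `x`. -/
def ball (x : V) (i : ℕ) : PreAbstractSimplicialComplex V :=
  X.span {w | X.oneSkeleton.edist x w ≤ i}

/-- The combinatorial sphere `S_i(x)` around `x`. -/
def sphere (x : V) (i : ℕ) : PreAbstractSimplicialComplex V :=
  X.span {w | X.oneSkeleton.edist x w = i}

/-- `X` is a single simplex (together with its faces); in particular it is nonempty. -/
def IsSingleSimplex : Prop :=
  ∃ τ ∈ X.faces, ∀ ρ ∈ X.faces, ρ ⊆ τ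

/-- The property `SD~_n(x)`: simple descent on balls of radii at most `n` around `x`, in the form of
an edge condition and a vertex condition. -/
def WeakSimpleDescent (n : ℕ) (x : V) : Prop :=
  ∀ i : ℕ, 1 ≤ i → i ≤ n →
    (∀ e ∈ (X.sphere x (i + 1)).faces, e.card = 2 → (X.link e ⊓ X.ball x i).faces.Nonempty) ∧
    (∀ w : V, {w} ∈ (X.sphere x (i + 1)).faces → (X.link {w} ⊓ X.ball x i).IsSingleSimplex)

/-- Weakly systolic complexes: connected flag complexes that satisfy `SD~_n(x)` for every natural
number `n` and every vertex `x`. -/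
def IsWeaklySystolic : Prop :=
  ConnectedSpace X.Realization ∧ X.IsFlag ∧
    ∀ (n : ℕ) (x : V), {x} ∈ X.faces → X.WeakSimpleDescent n x

/-- `c` runs once around a cycle of length `n` in `X` which is a full subcomplex of `X`: every
simplex of `X` with all its vertices on the cycle is a vertex or an edge of the cycle. -/
def IsFullCycle (n : ℕ) (c : ZMod n → V) : Prop :=
  Function.Injective c ∧ (∀ j, X.oneSkeleton.Adj (c j) (c (j + 1))) ∧
    ∀ σ ∈ X.faces, (σ : Set V) ⊆ Set.range c → ∃ j, (σ : Set V) ⊆ {c j, c (j + 1)}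

/-- `X` is `k`-large: it is flag and every full cycle in `X` has length at least `k`
(cycles have length at least `4`). -/
def IsLarge (k : ℕ) : Prop :=
  X.IsFlag ∧ ∀ n : ℕ, 4 ≤ n → ∀ c : ZMod n → V, X.IsFullCycle n c → k ≤ n

/-- `X` is locally `k`-large: it is flag and the links of all its simplices are `k`-large. -/
def IsLocallyLarge (k : ℕ) : Prop :=
  X.IsFlag ∧ ∀ σ ∈ X.faces, (X.link σ).IsLarge k

/-- Systolic complexes: (connected and) simply connected, locally `6`-large complexes. -/
def IsSystolic : Prop :=
  SimplyConnectedSpace X.Realization ∧ X.IsLocallyLarge 6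

/-- `X` is finite dimensional: the dimensions of its simplices are bounded. -/
def IsFiniteDimensional : Prop :=
  ∃ d : ℕ, ∀ σ ∈ X.faces, σ.card ≤ d + 1

/-- The `1`-skeleton of `X` contains no infinite clique. -/
def NoInfiniteClique : Prop :=
  ∀ S : Set V, X.oneSkeleton.IsClique S → S.Finite

/-- The group of simplicial automorphisms of `X`. -/
def Aut : Subgroup (Equiv.Perm V) where
  carrier := {g | ∀ σ : Finset V, σ.map g.toEmbedding ∈ X.faces ↔ σ ∈ X.faces}
  one_mem' := fun σ => by
    have : σ.map (1 : Equiv.Perm V).toEmbedding = σ := by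
      ext a; simp only [Finset.mem_map_equiv]; rfl
    rw [this]
  mul_mem' := fun {g h} hg hh σ => by
    have : σ.map (g * h).toEmbedding = (σ.map h.toEmbedding).map g.toEmbedding := by
      rw [Finset.map_map]; rfl
    rw [this, hg, hh]
  inv_mem' := fun {g} hg σ => by
    have : (σ.map (g⁻¹).toEmbedding).map g.toEmbedding = σ := by
      ext a
      simp only [Finset.mem_map_equiv]
      have ha : (Equiv.symm g⁻¹) (g.symm a) = a := g.apply_symm_apply a
      rw [ha]
    rw [← hg, this]

/-- Automorphisms act on the realization by permuting barycentric coordinates. -/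
instance : MulAction X.Aut X.Realization where
  smul g p := ⟨p.1.equivMapDomain g.1, by
    refine ⟨?_, fun w => ?_, ?_⟩
    · have h : (p.1.equivMapDomain g.1).support = p.1.support.map g.1.toEmbedding := rfl
      rw [h]
      exact (g.2 _).2 p.2.1
    · rw [Finsupp.equivMapDomain_apply]
      exact p.2.2.1 _
    · rw [Finsupp.sum_equivMapDomain]
      exact p.2.2.2⟩
  one_smul p := Subtype.ext (Finsupp.equivMapDomain_refl p.1)
  mul_smul g h p := Subtype.ext (Finsupp.equivMapDomain_trans h.1 g.1 p.1)

/-- A simplicial action of `G` on `X` is geometric if the induced action on the realization is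
properly discontinuous and cocompact. -/
def ActsGeometrically {G : Type u} [Group G] (φ : G →* X.Aut) : Prop :=
  letI : MulAction G X.Realization := MulAction.compHom X.Realization φ
  ProperlyDiscontinuousSMul G X.Realization ∧
    CompactSpace (Quotient (MulAction.orbitRel G X.Realization))

end Basic

end PreAbstractSimplicialComplex

/-- A group is systolic if it acts geometrically, by simplicial automorphisms, on some systolic
complex. -/
def IsSystolicGroup (G : Type u) [Group G] : Prop :=
  ∃ (V : Type v) (X : PreAbstractSimplicialComplex V) (φ : G →* X.Aut),
    X.IsSystolic ∧ X.ActsGeometrically φ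

/-- A group is weakly systolic if it acts geometrically, by simplicial automorphisms, on some weakly
systolic complex. -/
def IsWeaklySystolicGroup (G : Type u) [Group G] : Prop :=
  ∃ (V : Type v) (X : PreAbstractSimplicialComplex V) (φ : G →* X.Aut),
    X.IsWeaklySystolic ∧ X.ActsGeometrically φ

end

/-! The core is a reconstruction of `X` from a vertex `x`. The 1-skeleton is unfolded level by
level: a vertex of level `n` receives a new neighbour on level `n + 1` for every edge not yet lifted
there, and new vertices over the same point are glued when their parents are adjacent. The absence
of short full cycles in links enters only through `NoLocalShortCycle`: 4- and 5-cycles among the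
neighbours of a vertex have a diagonal. By induction on the level (`GoodAt`) it follows that the
parents of a vertex form a clique, and that the projection is injective on the neighbours of each
vertex and reflects adjacency between them. So the flag complex of the unfolding is a path connected
simplicial covering of `X`, and simple connectivity makes the projection injective (`p_injective`).
The level is then the distance from `x`, the edge condition is built into the construction, and the
vertex condition is the clique property of parents; without infinite cliques this clique is finite,
hence a simplex. This is (1).

For (2), the function taking a point to the reciprocal of the sum of its squared coordinates is
continuous and invariant, and equals the number of vertices of a simplex at its barycentre.
Cocompactness bounds it, so the complex is finite dimensional and (1) applies to the same complex
and action.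

For (3), each sphere around `x` is well-ordered by comparing first the least neighbours on the
previous sphere; that least neighbour is the parent. Diagonals of 4- and 5-cycles again show that
parents of adjacent vertices are equal or adjacent, and that the parent of the later of two adjacent
vertices is equal or adjacent to the earlier one (`parent_sphere`). Hence the vertices of a simplex
can be replaced by their parents one at a time from the top, without leaving the complex. Moving
barycentric mass in this order is a homotopy from the identity to the parent map. Infinitely many
copies of it, run on the intervals from 1 - 2⁻ⁿ to 1 - 2⁻ⁿ⁻¹, compose to a contraction, because on
each closed simplex all but finitely many of them are stationary. -/

noncomputable section

namespace PreAbstractSimplicialComplex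

/-! ### The weak topology: continuity and openness tested on closed simplices. -/

section RealizationTopology

variable {V : Type v} {X : PreAbstractSimplicialComplex V}

/-- The closed simplex spanned by `σ`, with the topology induced by barycentric coordinates. -/
def FaceSpace (X : PreAbstractSimplicialComplex V) (σ : Finset V) : Type v :=
  X.closedSimplex σ

instance (σ : Finset V) : TopologicalSpace (X.FaceSpace σ) :=
  TopologicalSpace.induced (fun (p : X.closedSimplex σ) (w : V) => (p : X.Realization).1 w)
    inferInstance

/-- The inclusion of a closed simplex into the realization. -/
def FaceSpace.incl {σ : Finset V} (p : X.FaceSpace σ) : X.Realization := Subtype.val p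

theorem FaceSpace.support_subset {σ : Finset V} (p : X.FaceSpace σ) : p.incl.1.support ⊆ σ :=
  Subtype.property p

theorem FaceSpace.continuous_coord {σ : Finset V} (w : V) :
    Continuous (fun p : X.FaceSpace σ => p.incl.1 w) :=
  (continuous_apply w).comp continuous_induced_dom

theorem FaceSpace.continuous_mk {Y : Type*} [TopologicalSpace Y] {σ : Finset V}
    {g : Y → X.FaceSpace σ} (h : ∀ w, Continuous fun y => (g y).incl.1 w) : Continuous g :=
  continuous_induced_rng.2 (continuous_pi h)

theorem FaceSpace.continuous_incl {σ : Finset V} (hσ : σ ∈ X.faces) :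
    Continuous (FaceSpace.incl : X.FaceSpace σ → X.Realization) :=
  continuous_iff_coinduced_le.2 (le_iSup
    (fun σ : X.faces => TopologicalSpace.coinduced (FaceSpace.incl : X.FaceSpace σ → X.Realization)
      inferInstance) ⟨σ, hσ⟩)

theorem realization_continuous_iff {Y : Type*} [TopologicalSpace Y] {g : X.Realization → Y} :
    Continuous g ↔ ∀ σ ∈ X.faces, Continuous (fun p : X.FaceSpace σ => g p.incl) := by
  refine ⟨fun h σ hσ => h.comp (FaceSpace.continuous_incl hσ), fun h => ?_⟩
  exact continuous_iSup_dom.2 fun σ => continuous_coinduced_dom.2 (h σ σ.2)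

theorem realization_isOpen_iff {U : Set X.Realization} :
    IsOpen U ↔ ∀ σ ∈ X.faces, IsOpen (FaceSpace.incl ⁻¹' U : Set (X.FaceSpace σ)) := by
  refine ⟨fun h σ hσ => h.preimage (FaceSpace.continuous_incl hσ), fun h => ?_⟩
  exact isOpen_iSup_iff.2 fun σ => isOpen_coinduced.2 (h σ σ.2)

theorem Realization.continuous_coord (w : V) : Continuous (fun p : X.Realization => p.1 w) :=
  realization_continuous_iff.2 fun _ _ => FaceSpace.continuous_coord w

theorem Realization.ext {p q : X.Realization} (h : ∀ w, p.1 w = q.1 w) : p = q :=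
  Subtype.ext (Finsupp.ext h)

/-- A map into the realization is continuous if its coordinates are continuous and it only meets
finitely many simplices. -/
theorem Realization.continuous_of_coord {Y : Type*} [TopologicalSpace Y] {g : Y → X.Realization}
    (T : Finset V) (hT : ∀ y, (g y).1.support ⊆ T) (hg : ∀ w, Continuous fun y => (g y).1 w) :
    Continuous g := by
  classical
  -- The finitely many faces inside `T` give a finite closed cover of `Y`, and on each piece the map
  -- factors through a single closed simplex.
  let A : {ρ // ρ ∈ T.powerset ∧ ρ ∈ X.faces} → Set Y := fun ρ => {y | (g y).1.support ⊆ ρ.1}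
  have : Finite {ρ // ρ ∈ T.powerset ∧ ρ ∈ X.faces} :=
    Finite.of_injective (fun ρ => (⟨ρ.1, ρ.2.1⟩ : T.powerset)) fun a b h => by
      ext1; simpa using h
  refine LocallyFinite.continuous (f := A) (locallyFinite_of_finite _) ?_ ?_ ?_
  · refine Set.eq_univ_of_forall fun y => Set.mem_iUnion.2 ⟨⟨(g y).1.support, ?_, (g y).2.1⟩, ?_⟩
    · exact Finset.mem_powerset.2 (hT y)
    · exact Finset.Subset.refl _
  · intro ρ
    have : A ρ = ⋂ w ∈ (ρ.1 : Set V)ᶜ, {y | (g y).1 w = 0} := by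
      ext y
      simp only [A, Set.mem_ofPred_eq, Set.mem_iInter, Finset.subset_iff, Finsupp.mem_support_iff]
      exact forall_congr' fun w => not_imp_comm
    rw [this]
    exact isClosed_biInter fun w _ => isClosed_eq (hg w) continuous_const
  · intro ρ
    rw [continuousOn_iff_continuous_domRestrict]
    let k : A ρ → X.FaceSpace ρ.1 := fun y => ⟨g y, y.2⟩
    have hk : Continuous k :=
      FaceSpace.continuous_mk fun w => (hg w).comp continuous_subtype_val
    exact (FaceSpace.continuous_incl ρ.2.2).comp hk

theorem support_nonempty_of_sum {p : V →₀ ℝ} (h : p.sum (fun _ t => t) = 1) :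
    p.support.Nonempty := by
  rw [Finset.nonempty_iff_ne_empty]
  intro h0
  rw [Finsupp.sum, h0, Finset.sum_empty] at h
  exact zero_ne_one h

/-- The vertex `w`, as a point of the realization. -/
def Realization.vertex {w : V} (hw : {w} ∈ X.faces) : X.Realization :=
  ⟨Finsupp.single w 1, by
    rw [Finsupp.support_single _ one_ne_zero]
    refine ⟨hw, fun a => ?_, by simp⟩
    classical
    rw [Finsupp.single_apply]
    split_ifs <;> norm_num⟩

theorem Realization.vertex_injective {w w' : V} {hw : {w} ∈ X.faces} {hw' : {w'} ∈ X.faces}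
    (h : vertex hw = vertex hw') : w = w' :=
  (Finsupp.single_left_inj one_ne_zero).1 (congrArg Subtype.val h)

theorem face_nonempty {σ : Finset V} (h : σ ∈ X.faces) : σ.Nonempty := (X.isRelLowerSet_faces h).1

theorem face_mono {σ τ : Finset V} (h : σ ∈ X.faces) (hτ : τ ⊆ σ) (hne : τ.Nonempty) :
    τ ∈ X.faces := (X.isRelLowerSet_faces h).2 hτ hne

theorem face_singleton {σ : Finset V} (h : σ ∈ X.faces) {a : V} (ha : a ∈ σ) : {a} ∈ X.faces :=
  face_mono h (Finset.singleton_subset_iff.2 ha) (Finset.singleton_nonempty a)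

theorem Realization.sum_eq_one (p : X.Realization) {σ : Finset V} (h : p.1.support ⊆ σ) :
    ∑ w ∈ σ, p.1 w = 1 := by
  exact (Finsupp.sum_of_support_subset p.1 h (fun _ t => t) (fun _ _ => rfl)).symm.trans p.2.2.2

theorem Realization.pos_of_mem (p : X.Realization) {w : V} (h : w ∈ p.1.support) : 0 < p.1 w :=
  lt_of_le_of_ne (p.2.2.1 w) (Finsupp.mem_support_iff.1 h).symm

end RealizationTopology

/-! ### Maps of realizations induced by simplicial maps. -/

section Maps

open Classical in
theorem mapDomain_apply_of_subset {V W : Type*} (f : V → W) (p : V →₀ ℝ) {σ : Finset V}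
    (h : p.support ⊆ σ) (w : W) :
    p.mapDomain f w = ∑ a ∈ σ, if f a = w then p a else 0 := by
  rw [Finsupp.mapDomain, Finsupp.sum_of_support_subset _ h _ (fun _ _ => by simp),
    Finsupp.finsetSum_apply]
  exact Finset.sum_congr rfl fun a _ => Finsupp.single_apply

open Classical in
-- Nonnegative coefficients cannot cancel when they are added up along fibres.
theorem support_mapDomain_of_nonneg {V W : Type*} (f : V → W) (p : V →₀ ℝ) (h : ∀ a, 0 ≤ p a) :
    (p.mapDomain f).support = p.support.image f := by
  refine Finset.Subset.antisymm Finsupp.mapDomain_support fun w hw => ?_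
  obtain ⟨a, ha, rfl⟩ := Finset.mem_image.1 hw
  rw [Finsupp.mem_support_iff, mapDomain_apply_of_subset f p (Finset.Subset.refl _)]
  refine (Finset.sum_pos' (fun b _ => ?_) ⟨a, ha, ?_⟩).ne'
  · split_ifs
    exacts [h b, le_rfl]
  · rw [if_pos rfl]
    exact lt_of_le_of_ne (h a) (Finsupp.mem_support_iff.1 ha).symm

variable {V W : Type*} {X : PreAbstractSimplicialComplex V} {Y : PreAbstractSimplicialComplex W}

open Classical in
/-- The point with the barycentric coordinates of `p` pushed forward along the vertex map `f`. -/
def Realization.push (p : X.Realization) (f : V → W) (h : p.1.support.image f ∈ Y.faces) :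
    Y.Realization :=
  ⟨p.1.mapDomain f, by
    rw [support_mapDomain_of_nonneg f p.1 p.2.2.1]
    refine ⟨h, fun w => ?_, ?_⟩
    · rw [mapDomain_apply_of_subset f p.1 (Finset.Subset.refl _)]
      refine Finset.sum_nonneg fun a _ => ?_
      split_ifs
      exacts [p.2.2.1 a, le_rfl]
    · rw [Finsupp.sum_mapDomain_index (fun _ => rfl) (fun _ _ _ => rfl)]
      exact p.2.2.2⟩

open Classical in
/-- The map of realizations induced by a simplicial map. -/
def Realization.map (f : V → W) (hf : ∀ σ ∈ X.faces, σ.image f ∈ Y.faces) (p : X.Realization) :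
    Y.Realization :=
  p.push f (hf _ p.2.1)

open Classical in
theorem Realization.continuous_map (f : V → W) (hf : ∀ σ ∈ X.faces, σ.image f ∈ Y.faces) :
    Continuous (Realization.map f hf) := by
  refine realization_continuous_iff.2 fun σ _ => ?_
  refine Realization.continuous_of_coord (σ.image f) (fun p => ?_) fun w => ?_
  · exact Finsupp.mapDomain_support.trans (Finset.image_subset_image p.support_subset)
  · have : (fun p : X.FaceSpace σ => (Realization.map f hf p.incl).1 w) =
        fun p => ∑ a ∈ σ, if f a = w then p.incl.1 a else 0 :=
      funext fun p => mapDomain_apply_of_subset f _ p.support_subset w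
    rw [this]
    refine continuous_finsetSum _ fun a _ => ?_
    split_ifs
    exacts [FaceSpace.continuous_coord a, continuous_const]

end Maps

end PreAbstractSimplicialComplex

namespace PreAbstractSimplicialComplex

/-! ### Simplicial coverings induce covering maps. -/

section Covering

variable {V W : Type*} {X : PreAbstractSimplicialComplex V} {Y : PreAbstractSimplicialComplex W}

open Classical in
/-- A vertex map `f` is a simplicial covering if it is simplicial, injective on simplices, and
simplices lift uniquely once a lift of one of their vertices is given. -/
structure IsSimplicialCovering (Y : PreAbstractSimplicialComplex W)
    (X : PreAbstractSimplicialComplex V) (f : W → V) : Prop where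
  image_mem : ∀ σ ∈ Y.faces, σ.image f ∈ X.faces
  injOn : ∀ σ ∈ Y.faces, Set.InjOn f σ
  exists_lift : ∀ w, {w} ∈ Y.faces → ∀ σ ∈ X.faces, f w ∈ σ → ∃ τ ∈ Y.faces, w ∈ τ ∧ τ.image f = σ
  unique_lift : ∀ τ ∈ Y.faces, ∀ τ' ∈ Y.faces, ∀ w ∈ τ, w ∈ τ' → τ.image f = τ'.image f → τ = τ'

namespace IsSimplicialCovering

variable {f : W → V}

open Classical in
-- The covering maps the lift of `σ` through `w` bijectively onto `σ`, so pushing coordinates along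
-- the inverse bijection is a section over the closed simplex. The last clause places it in the open
-- star of `w` wherever the coordinate at `f w` is nonzero.
theorem exists_section (h : IsSimplicialCovering Y X f) {w : W} (hw : {w} ∈ Y.faces) {σ : Finset V}
    (hσ : σ ∈ X.faces) (hwσ : f w ∈ σ) :
    ∃ s : X.FaceSpace σ → Y.Realization, Continuous s ∧
      (∀ p, Realization.map f h.image_mem (s p) = p.incl) ∧ ∀ p, (s p).1 w = p.incl.1 (f w) := by
  obtain ⟨τ, hτ, hwτ, rfl⟩ := h.exists_lift w hw σ hσ hwσ
  have : Nonempty W := ⟨w⟩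
  let g := Function.invFunOn f τ
  have hg : ∀ a ∈ τ, g (f a) = a := fun a ha => (h.injOn τ hτ).leftInvOn_invFunOn ha
  have hgτ : (τ.image f).image g = τ := by
    ext a
    simp only [Finset.mem_image, exists_exists_and_eq_and]
    constructor
    · rintro ⟨b, hb, rfl⟩; rwa [hg b hb]
    · exact fun ha => ⟨a, ha, hg a ha⟩
  have hsub : ∀ p : X.FaceSpace (τ.image f), p.incl.1.support.image g ⊆ τ := fun p =>
    (Finset.image_subset_image p.support_subset).trans hgτ.subset
  let s : X.FaceSpace (τ.image f) → Y.Realization := fun p => p.incl.push g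
    (face_mono hτ (hsub p) ((face_nonempty p.incl.2.1).image g))
  have hs : ∀ p, (s p).1 = p.incl.1.mapDomain g := fun p => rfl
  have hinj : Set.InjOn g (τ.image f) := by
    intro a ha b hb hab
    obtain ⟨a, ha', rfl⟩ := Finset.mem_image.1 ha
    obtain ⟨b, hb', rfl⟩ := Finset.mem_image.1 hb
    rw [hg a ha', hg b hb'] at hab
    rw [hab]
  refine ⟨s, ?_, fun p => ?_, fun p => ?_⟩
  · refine Realization.continuous_of_coord τ (fun p => ?_) fun b => ?_
    · rw [hs]; exact Finsupp.mapDomain_support.trans (hsub p)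
    · have : (fun p => (s p).1 b) = fun p : X.FaceSpace (τ.image f) =>
          ∑ a ∈ τ.image f, if g a = b then p.incl.1 a else 0 :=
        funext fun p => mapDomain_apply_of_subset g _ p.support_subset b
      rw [this]
      refine continuous_finsetSum _ fun a _ => ?_
      split_ifs
      exacts [FaceSpace.continuous_coord a, continuous_const]
  · refine Subtype.ext ?_
    change (p.incl.1.mapDomain g).mapDomain f = p.incl.1
    rw [← Finsupp.mapDomain_comp]
    refine (Finsupp.mapDomain_congr (g := id) fun a ha => ?_).trans Finsupp.mapDomain_id
    obtain ⟨a, ha', rfl⟩ := Finset.mem_image.1 (p.support_subset ha)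
    simp [hg a ha']
  · rw [hs]
    have := Finsupp.mapDomain_apply' (τ.image f : Set V) p.incl.1
      (by exact_mod_cast p.support_subset) (by exact_mod_cast hinj) (a := f w)
      (by exact_mod_cast hwσ)
    rwa [hg w hwτ] at this

open Classical in
theorem map_apply (h : IsSimplicialCovering Y X f) (p : Y.Realization) {w : W}
    (hw : w ∈ p.1.support) : (Realization.map f h.image_mem p).1 (f w) = p.1 w :=
  Finsupp.mapDomain_apply' (p.1.support : Set W) p.1 subset_rfl (h.injOn _ p.2.1) hw

open Classical in
theorem support_map (h : IsSimplicialCovering Y X f) (p : Y.Realization) :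
    (Realization.map f h.image_mem p).1.support = p.1.support.image f :=
  support_mapDomain_of_nonneg f p.1 p.2.2.1

open Classical in
/-- A simplicial covering induces a covering map of realizations. -/
theorem isCoveringMap (h : IsSimplicialCovering Y X f) :
    IsCoveringMap (Realization.map f h.image_mem) := by
  intro x
  obtain ⟨v, hv⟩ := face_nonempty x.2.1
  let P := Realization.map f h.image_mem
  have hP : Continuous P := Realization.continuous_map f h.image_mem
  -- The open star of `v` is evenly covered by the open stars of the vertices over `v`.
  let O : Set X.Realization := {p | p.1 v ≠ 0}
  have hO : IsOpen O := isOpen_ne_fun (Realization.continuous_coord v) continuous_const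
  have hxO : x ∈ O := Finsupp.mem_support_iff.1 hv
  let ι := {w : W // {w} ∈ Y.faces ∧ f w = v}
  let U : ι → Set Y.Realization := fun w => {p | p.1 w.1 ≠ 0}
  have hU : ∀ w, IsOpen (U w) := fun w =>
    isOpen_ne_fun (Realization.continuous_coord w.1) continuous_const
  have hcover : P ⁻¹' O ⊆ ⋃ i, U i := by
    intro p hp
    have : v ∈ (P p).1.support := Finsupp.mem_support_iff.2 hp
    rw [h.support_map] at this
    obtain ⟨w, hw, hwv⟩ := Finset.mem_image.1 this
    exact Set.mem_iUnion.2 ⟨⟨w, face_singleton p.2.1 hw, hwv⟩, Finsupp.mem_support_iff.1 hw⟩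
  rcases isEmpty_or_nonempty ι with hι | ⟨⟨w₀⟩⟩
  · refine (IsEvenlyCovered.of_preimage_eq_empty Empty (hO.mem_nhds hxO)
      ?_).to_isEvenlyCovered_preimage
    refine Set.eq_empty_of_subset_empty (hcover.trans ?_)
    rw [Set.iUnion_of_empty]
  have : Nonempty (X.Realization → Y.Realization) := ⟨fun _ => Realization.vertex w₀.2.1⟩
  have : Nonempty ι := ⟨w₀⟩
  let _ : TopologicalSpace ι := ⊥
  have : DiscreteTopology ι := ⟨rfl⟩
  refine IsEvenlyCovered.to_isEvenlyCovered_preimage (I := ι) (.of_trivialization (t :=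
    IsOpen.trivializationDiscrete (f := P) U O hO ?_ ?_ ?_ ?_ hcover) hxO)
  · rintro ⟨w, hw, rfl⟩ D hD
    refine ⟨fun h' => (h'.preimage hP).inter (hU _), fun h' => ?_⟩
    refine realization_isOpen_iff.2 fun σ hσ => ?_
    -- If `f w ∈ σ`, the trace of `D` on the closed simplex is the preimage of an open set under the
    -- section through `w`; otherwise the simplex misses the star, and the trace is empty.
    by_cases hwσ : f w ∈ σ
    · obtain ⟨s, hs, hs1, hs2⟩ := h.exists_section hw hσ hwσ
      convert h'.preimage hs using 1
      ext p
      simp only [Set.mem_preimage, Set.mem_inter_iff, U, P, hs1, Set.mem_ofPred_eq, hs2]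
      exact ⟨fun hp => ⟨hp, hD hp⟩, And.left⟩
    · convert isOpen_empty
      refine Set.eq_empty_of_forall_notMem fun p hp => hwσ (p.support_subset ?_)
      exact Finsupp.mem_support_iff.2 (hD hp)
  · rintro ⟨w, hw, rfl⟩ p hp q hq hpq
    have hsupp : p.1.support = q.1.support := by
      refine h.unique_lift _ p.2.1 _ q.2.1 w (Finsupp.mem_support_iff.2 hp)
        (Finsupp.mem_support_iff.2 hq) ?_
      rw [← h.support_map, ← h.support_map]
      exact congrArg (fun r : X.Realization => r.1.support) hpq
    refine Realization.ext fun a => ?_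
    by_cases ha : a ∈ p.1.support
    · rw [← h.map_apply p ha, ← h.map_apply q (hsupp ▸ ha)]
      exact congrArg (fun r : X.Realization => r.1 (f a)) hpq
    · rw [Finsupp.notMem_support_iff.1 ha, Finsupp.notMem_support_iff.1 (hsupp ▸ ha)]
  · rintro ⟨w, hw, rfl⟩ p hp
    obtain ⟨s, -, hs1, hs2⟩ := h.exists_section hw p.2.1 (Finsupp.mem_support_iff.2 hp)
    let p' : X.FaceSpace p.1.support := ⟨p, Finset.Subset.refl _⟩
    refine ⟨s p', ?_, hs1 p'⟩
    change (s p').1 w ≠ 0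
    rw [hs2 p']
    exact hp
  · intro w w' hne
    refine Set.disjoint_left.2 fun p hp hp' => hne (Subtype.ext ?_)
    exact h.injOn _ p.2.1 (Finsupp.mem_support_iff.2 hp) (Finsupp.mem_support_iff.2 hp')
      (w.2.2.trans w'.2.2.symm)

/-- A simplicial covering of a simply connected complex by a path connected one is injective on
vertices. -/
theorem injOn_vertices (h : IsSimplicialCovering Y X f) [SimplyConnectedSpace X.Realization]
    [PathConnectedSpace Y.Realization] {w w' : W} (hw : {w} ∈ Y.faces) (hw' : {w'} ∈ Y.faces)
    (hf : f w = f w') : w = w' := by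
  classical
  let P := Realization.map f h.image_mem
  have cov : IsCoveringMap P := h.isCoveringMap
  let γ : Path (Realization.vertex hw) (Realization.vertex hw') := PathConnectedSpace.somePath _ _
  have hPv : ∀ {a} (ha : {a} ∈ Y.faces), (P (Realization.vertex ha)).1 = Finsupp.single (f a) 1 :=
    fun ha => Finsupp.mapDomain_single
  have hend : P (Realization.vertex hw') = P (Realization.vertex hw) :=
    Subtype.ext ((hPv hw').trans ((congrArg (fun c => Finsupp.single c (1 : ℝ)) hf.symm).trans (hPv hw).symm))
  let γ₀ : Path (P (Realization.vertex hw)) (P (Realization.vertex hw)) :=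
    (γ.map cov.continuous).cast rfl hend.symm
  -- The image of `γ` is a null-homotopic loop, so its lift `γ` ends where the lift of the constant
  -- loop ends.
  obtain ⟨H⟩ := SimplyConnectedSpace.paths_homotopic γ₀ (Path.refl _)
  have key := cov.liftPath_apply_one_eq_of_homotopicRel ⟨H⟩ (Realization.vertex hw)
    γ₀.source (Path.refl _).source
  have h1 : γ.toContinuousMap = cov.liftPath γ₀.toContinuousMap (Realization.vertex hw)
      γ₀.source := (cov.eq_liftPath_iff' _).2 ⟨rfl, γ.source⟩
  have h2 : ContinuousMap.const unitInterval (Realization.vertex hw) =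
      cov.liftPath (Path.refl (P (Realization.vertex hw))).toContinuousMap (Realization.vertex hw)
      (Path.refl _).source := (cov.eq_liftPath_iff' _).2 ⟨rfl, rfl⟩
  have h3 : γ 1 = Realization.vertex hw :=
    (DFunLike.congr_fun h1 1).trans (key.trans (DFunLike.congr_fun h2 1).symm)
  exact Realization.vertex_injective (h3.symm.trans γ.target)

end IsSimplicialCovering

end Covering

/-! ### Connectedness of the realization versus edge paths. -/

section Connected

variable {V : Type*} {X : PreAbstractSimplicialComplex V}

open Classical in
theorem Realization.joined_vertex {a b : V} (h : {a, b} ∈ X.faces) :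
    Joined (Realization.vertex (face_singleton h (Finset.mem_insert_self a {b})))
      (Realization.vertex (face_singleton h (Finset.mem_insert_of_mem (Finset.mem_singleton_self b))))
    := by
  let q : unitInterval → V →₀ ℝ := fun t =>
    Finsupp.single a (1 - (t : ℝ)) + Finsupp.single b (t : ℝ)
  have hsub : ∀ t, (q t).support ⊆ {a, b} := fun t => Finsupp.support_add.trans
    (Finset.union_subset (Finsupp.support_single_subset.trans (by simp))
      (Finsupp.support_single_subset.trans (by simp)))
  have hsum : ∀ t, (q t).sum (fun _ t => t) = 1 := fun t => by
    rw [Finsupp.sum_add_index' (fun _ => rfl) (fun _ _ _ => rfl), Finsupp.sum_single_index rfl,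
      Finsupp.sum_single_index rfl, sub_add_cancel]
  let g : unitInterval → X.Realization := fun t => ⟨q t,
    face_mono h (hsub t) (support_nonempty_of_sum (hsum t)), fun w => by
      have h0 := t.2.1
      have h1 := t.2.2
      simp only [q, Finsupp.add_apply, Finsupp.single_apply]
      split_ifs <;> linarith, hsum t⟩
  have hg : Continuous g := by
    refine Realization.continuous_of_coord {a, b} hsub fun w => ?_
    change Continuous fun t : unitInterval => (q t) w
    simp only [q, Finsupp.add_apply, Finsupp.single_apply]
    split_ifs <;> fun_prop
  refine ⟨⟨⟨g, hg⟩, ?_, ?_⟩⟩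
  · exact Subtype.ext (by simp [g, q, Realization.vertex])
  · exact Subtype.ext (by simp [g, q, Realization.vertex])

open Classical in
theorem Realization.joined_vertex_of_mem (p : X.Realization) {a : V} (ha : a ∈ p.1.support) :
    Joined (Realization.vertex (face_singleton p.2.1 ha)) p := by
  let q : unitInterval → V →₀ ℝ := fun t =>
    (1 - (t : ℝ)) • Finsupp.single a (1 : ℝ) + (t : ℝ) • p.1
  have hsub : ∀ t, (q t).support ⊆ p.1.support := fun t => Finsupp.support_add.trans
    (Finset.union_subset (Finsupp.support_smul.trans (Finsupp.support_single_subset.trans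
      (Finset.singleton_subset_iff.2 ha))) Finsupp.support_smul)
  have hsum : ∀ t, (q t).sum (fun _ t => t) = 1 := fun t => by
    rw [Finsupp.sum_add_index' (fun _ => rfl) (fun _ _ _ => rfl),
      Finsupp.sum_smul_index' (fun _ => rfl), Finsupp.sum_smul_index' (fun _ => rfl),
      Finsupp.sum_single_index (by simp)]
    have : (p.1.sum fun _ c => (t : ℝ) • c) = (t : ℝ) * 1 :=
      (Finsupp.mul_sum _ _).symm.trans (congrArg ((t : ℝ) * ·) p.2.2.2)
    rw [this]
    simp
  let g : unitInterval → X.Realization := fun t => ⟨q t,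
    face_mono p.2.1 (hsub t) (support_nonempty_of_sum (hsum t)), fun w => by
      have h0 := t.2.1
      have h1 : 0 ≤ 1 - (t : ℝ) := sub_nonneg.2 t.2.2
      have h2 := mul_nonneg h0 (p.2.2.1 w)
      simp only [q, Finsupp.add_apply, Finsupp.smul_apply, Finsupp.single_apply, smul_eq_mul]
      split_ifs <;> linarith, hsum t⟩
  have hg : Continuous g := by
    refine Realization.continuous_of_coord p.1.support hsub fun w => ?_
    change Continuous fun t : unitInterval => (q t) w
    simp only [q, Finsupp.add_apply, Finsupp.smul_apply, Finsupp.single_apply, smul_eq_mul]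
    split_ifs <;> fun_prop
  refine ⟨⟨⟨g, hg⟩, ?_, ?_⟩⟩
  · exact Subtype.ext (by simp [g, q, Realization.vertex])
  · exact Subtype.ext (by simp [g, q])

open Classical in
theorem pathConnectedSpace_of_chain {x : V} (hx : {x} ∈ X.faces)
    (h : ∀ w, {w} ∈ X.faces → Relation.ReflTransGen (fun a b => {a, b} ∈ X.faces) x w) :
    PathConnectedSpace X.Realization := by
  have key : ∀ w, Relation.ReflTransGen (fun a b => {a, b} ∈ X.faces) x w →
      ∀ hw : {w} ∈ X.faces, Joined (Realization.vertex hx) (Realization.vertex hw) := by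
    intro w hw
    induction hw with
    | refl => exact fun _ => Joined.refl _
    | tail _ hbc ih => exact fun _ => (ih _).trans (Realization.joined_vertex hbc)
  have hall : ∀ p : X.Realization, Joined (Realization.vertex hx) p := fun p => by
    obtain ⟨a, ha⟩ := face_nonempty p.2.1
    exact (key a (h a (face_singleton p.2.1 ha)) _).trans (p.joined_vertex_of_mem ha)
  exact ⟨⟨Realization.vertex hx⟩, fun p q => (hall p).symm.trans (hall q)⟩

open Classical in
/-- In a connected complex, a set of vertices closed under passing to neighbours is everything. -/
theorem mem_of_closed_under_edges [PreconnectedSpace X.Realization] {C : Set V} {x : V}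
    (hx : {x} ∈ X.faces) (hxC : x ∈ C) (hC : ∀ a b, {a, b} ∈ X.faces → a ∈ C → b ∈ C) {w : V}
    (hw : {w} ∈ X.faces) : w ∈ C := by
  let A : Set X.Realization := {p | ∃ a ∈ p.1.support, a ∈ C}
  -- The vertices of a simplex are pairwise joined, so `A` contains all of a closed simplex or none
  -- of it; hence `A` is clopen.
  have hpre : ∀ σ ∈ X.faces, (FaceSpace.incl ⁻¹' A : Set (X.FaceSpace σ)) = ∅ ∨
      (FaceSpace.incl ⁻¹' A : Set (X.FaceSpace σ)) = Set.univ := by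
    intro σ hσ
    by_cases h : ∃ a ∈ σ, a ∈ C
    · right
      obtain ⟨a, ha, haC⟩ := h
      refine Set.eq_univ_of_forall fun p => ?_
      obtain ⟨b, hb⟩ := face_nonempty p.incl.2.1
      refine ⟨b, hb, hC a b (face_mono hσ ?_ (Finset.insert_nonempty a {b})) haC⟩
      exact Finset.insert_subset ha (Finset.singleton_subset_iff.2 (p.support_subset hb))
    · left
      refine Set.eq_empty_of_forall_notMem fun p ⟨a, ha, haC⟩ => h ⟨a, p.support_subset ha, haC⟩
  have hclopen : IsClopen A := by
    refine ⟨⟨realization_isOpen_iff.2 fun σ hσ => ?_⟩, realization_isOpen_iff.2 fun σ hσ => ?_⟩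
    · rw [Set.preimage_compl]
      rcases hpre σ hσ with h | h <;> rw [h] <;> simp
    · rcases hpre σ hσ with h | h <;> rw [h] <;> simp
  have hne : A.Nonempty := ⟨Realization.vertex hx, x, by
    rw [Realization.vertex, Finsupp.support_single _ one_ne_zero]; simp, hxC⟩
  have hu := hclopen.eq_univ hne
  obtain ⟨a, ha, haC⟩ : Realization.vertex hw ∈ A := hu ▸ Set.mem_univ _
  rw [Realization.vertex, Finsupp.support_single _ one_ne_zero, Finset.mem_singleton] at ha
  exact ha ▸ haC

end Connected

end PreAbstractSimplicialComplex

/-! ### Unfoldings of a graph: local faithfulness by induction on levels. -/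

/-- Four- and five-cycles in the neighbourhood of a vertex have diagonals. -/
structure SimpleGraph.NoLocalShortCycle {V : Type*} (G : SimpleGraph V) : Prop where
  four : ∀ c a₁ a₂ a₃ a₄, G.Adj c a₁ → G.Adj c a₂ → G.Adj c a₃ → G.Adj c a₄ →
    G.Adj a₁ a₂ → G.Adj a₂ a₃ → G.Adj a₃ a₄ → G.Adj a₄ a₁ → a₁ ≠ a₃ → a₂ ≠ a₄ →
    G.Adj a₁ a₃ ∨ G.Adj a₂ a₄
  five : ∀ c a₁ a₂ a₃ a₄ a₅, G.Adj c a₁ → G.Adj c a₂ → G.Adj c a₃ → G.Adj c a₄ → G.Adj c a₅ →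
    G.Adj a₁ a₂ → G.Adj a₂ a₃ → G.Adj a₃ a₄ → G.Adj a₄ a₅ → G.Adj a₅ a₁ →
    a₁ ≠ a₃ → a₁ ≠ a₄ → a₂ ≠ a₄ → a₂ ≠ a₅ → a₃ ≠ a₅ →
    G.Adj a₁ a₃ ∨ G.Adj a₁ a₄ ∨ G.Adj a₂ a₄ ∨ G.Adj a₂ a₅ ∨ G.Adj a₃ a₅

/-- A graph over `G`, layered by levels, in which each vertex at level `n + 1` is obtained by
following an edge of `G` that has no lift to the first `n` levels, two such vertices being identified
whenever they lie over the same vertex of `G` and stem from adjacent vertices of level `n`. -/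
structure Unfolding {V : Type v} (G : SimpleGraph V) (x : V) where
  W : Type v
  level : W → ℕ
  p : W → V
  A : W → W → Prop
  root : W
  symm : ∀ {a b}, A a b → A b a
  map_adj : ∀ {a b}, A a b → G.Adj (p a) (p b)
  level_le : ∀ {a b}, A a b → level b ≤ level a + 1
  level_root : level root = 0
  eq_root : ∀ {w}, level w = 0 → w = root
  p_root : p root = x
  exists_parent : ∀ {q}, level q ≠ 0 → ∃ w, level q = level w + 1 ∧ A w q
  exists_child : ∀ {w z}, G.Adj (p w) z → (∀ u, A w u → level u ≤ level w → p u ≠ z) →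
    ∃ q, level q = level w + 1 ∧ A w q ∧ p q = z
  fresh : ∀ {w q u}, A w q → level q = level w + 1 → A w u → level u ≤ level w → p u ≠ p q
  glue : ∀ {w q w' q'}, A w q → level q = level w + 1 → A w' q' → level q' = level w' + 1 →
    level w = level w' → w = w' ∨ A w w' → p q = p q' → q = q'
  -- Gluing generates an equivalence relation, so a priori two parents of `q` are only linked by a
  -- chain of adjacent parents.
  chain : ∀ {q w w'}, A w q → level q = level w + 1 → A w' q → level q = level w' + 1 →
    Relation.ReflTransGen (fun a b => A a b ∧ A a q ∧ A b q ∧ level q = level a + 1 ∧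
      level q = level b + 1) w w'
  exists_common_parent : ∀ {q q'}, A q q' → level q = level q' →
    ∃ w, level q = level w + 1 ∧ A w q ∧ A w q'
  adj_of : ∀ {w q q'}, A w q → A w q' → level q = level w + 1 → level q' = level w + 1 →
    G.Adj (p q) (p q') → A q q'

namespace Unfolding

variable {V : Type v} {G : SimpleGraph V} {x : V} (U : Unfolding G x)

theorem exists_lift {w : U.W} {z : V} (h : G.Adj (U.p w) z) : ∃ u, U.A w u ∧ U.p u = z := by
  by_cases h' : ∀ u, U.A w u → U.level u ≤ U.level w → U.p u ≠ z
  · obtain ⟨q, -, h1, h2⟩ := U.exists_child h h'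
    exact ⟨q, h1, h2⟩
  · push Not at h'
    obtain ⟨u, h1, -, h2⟩ := h'
    exact ⟨u, h1, h2⟩

/-- The projection is injective on, and reflects adjacency between, the neighbours of `w` that
satisfy `P`. -/
def FaithfulAt (w : U.W) (P : U.W → Prop) : Prop :=
  ∀ a b, U.A w a → U.A w b → P a → P b →
    (U.p a = U.p b → a = b) ∧ (G.Adj (U.p a) (U.p b) → U.A a b)

/-- The state of the induction along levels. -/
structure GoodAt (n : ℕ) : Prop where
  clique : ∀ q a b, U.level q = n → U.A a q → U.level q = U.level a + 1 → U.A b q →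
    U.level q = U.level b + 1 → a = b ∨ U.A a b
  below : ∀ w, U.level w < n → U.FaithfulAt w fun _ => True
  at_level : ∀ w, U.level w = n → U.FaithfulAt w fun a => U.level a ≤ n

variable {U} (hG : G.NoLocalShortCycle) {n : ℕ}

/-- Otherwise `y` would have a neighbour `z` over `U.p q`, of level at most that of `w`.
Faithfulness at `y` makes `z` adjacent to `w`, so the edge from `w` was already lifted when `q` was
created. -/
theorem GoodAt.not_adj_grandparent (h : U.GoodAt n) {y w q : U.W} (hw : U.level w = n)
    (hyw : U.A y w) (hy : U.level w = U.level y + 1) (hq : U.level q = U.level w + 1)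
    (hwq : U.A w q) : ¬ G.Adj (U.p y) (U.p q) := by
  intro hadj
  obtain ⟨z, hyz, hz⟩ := U.exists_lift hadj
  have hwz : U.A w z := (h.below y (by omega) w z hyw hyz trivial trivial).2
    (hz ▸ U.map_adj hwq)
  have := U.level_le hyz
  exact U.fresh hwq hq hwz (by omega) hz

include hG in
-- The common parents `y` of `w₁, w₂` and `y'` of `w₂, w₃` give, around `w₂`, the 4-cycle `q, w₁,
-- y', w₃` or `q, w₁, y, w₃` if the edge closing it exists, and otherwise the 5-cycle `q, w₁, y, y',
-- w₃`. Since `q` is not adjacent to grandparents, the diagonal must join `w₁` and `w₃`.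
theorem GoodAt.parents_trans (h : U.GoodAt n) {w₁ w₂ w₃ q : U.W} (h₁ : U.level w₁ = n)
    (h₂ : U.level w₂ = n) (h₃ : U.level w₃ = n) (hq : U.level q = n + 1) (hA₁ : U.A w₁ q)
    (hA₂ : U.A w₂ q) (hA₃ : U.A w₃ q) (h₁₂ : U.A w₁ w₂) (h₂₃ : U.A w₂ w₃) :
    w₁ = w₃ ∨ U.A w₁ w₃ := by
  by_contra! hcon
  obtain ⟨hne, hnA⟩ := hcon
  obtain ⟨y, hy, hy1, hy2⟩ := U.exists_common_parent h₁₂ (by omega)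
  obtain ⟨y', hy', hy'2, hy'3⟩ := U.exists_common_parent h₂₃ (by omega)
  have R := h.at_level w₂ h₂
  have hp13 : U.p w₁ ≠ U.p w₃ := fun e =>
    hne ((R w₁ w₃ (U.symm h₁₂) h₂₃ (by omega) (by omega)).1 e)
  have hn13 : ¬ G.Adj (U.p w₁) (U.p w₃) := fun e =>
    hnA ((R w₁ w₃ (U.symm h₁₂) h₂₃ (by omega) (by omega)).2 e)
  have hqy : ¬ G.Adj (U.p q) (U.p y) := fun e =>
    h.not_adj_grandparent h₂ hy2 (by omega) (by omega) hA₂ e.symm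
  have hqy' : ¬ G.Adj (U.p q) (U.p y') := fun e =>
    h.not_adj_grandparent h₂ hy'2 (by omega) (by omega) hA₂ e.symm
  have hqney : U.p q ≠ U.p y := (U.fresh hA₂ (by omega) (U.symm hy2) (by omega)).symm
  have hqney' : U.p q ≠ U.p y' := (U.fresh hA₂ (by omega) (U.symm hy'2) (by omega)).symm
  have g2 := @U.map_adj
  by_cases c1 : G.Adj (U.p w₁) (U.p y')
  · rcases hG.four (U.p w₂) (U.p q) (U.p w₁) (U.p y') (U.p w₃) (g2 hA₂) (g2 h₁₂).symm
      (g2 hy'2).symm (g2 h₂₃) (g2 hA₁).symm c1 (g2 hy'3) (g2 hA₃) hqney' hp13 with e | e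
    exacts [hqy' e, hn13 e]
  by_cases c3 : G.Adj (U.p y) (U.p w₃)
  · rcases hG.four (U.p w₂) (U.p q) (U.p w₁) (U.p y) (U.p w₃) (g2 hA₂) (g2 h₁₂).symm
      (g2 hy2).symm (g2 h₂₃) (g2 hA₁).symm (g2 hy1).symm c3 (g2 hA₃) hqney hp13 with e | e
    exacts [hqy e, hn13 e]
  have hyne : y ≠ y' := fun e => c1 (e ▸ (g2 hy1).symm)
  have hyy' : U.A y y' := (h.clique w₂ y y' h₂ hy2 (by omega) hy'2 (by omega)).resolve_left hyne
  have d1 : U.p w₁ ≠ U.p y' := fun e => by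
    have := (R w₁ y' (U.symm h₁₂) (U.symm hy'2) (by omega) (by omega)).1 e
    rw [this] at h₁
    omega
  have d3 : U.p y ≠ U.p w₃ := fun e => by
    have := (R y w₃ (U.symm hy2) h₂₃ (by omega) (by omega)).1 e
    rw [← this] at h₃
    omega
  rcases hG.five (U.p w₂) (U.p q) (U.p w₁) (U.p y) (U.p y') (U.p w₃) (g2 hA₂) (g2 h₁₂).symm
      (g2 hy2).symm (g2 hy'2).symm (g2 h₂₃) (g2 hA₁).symm (g2 hy1).symm (g2 hyy') (g2 hy'3)
      (g2 hA₃) hqney hqney' d1 hp13 d3 with e | e | e | e | e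
  exacts [hqy e, hqy' e, c1 e, hn13 e, c3 e]

include hG in
theorem GoodAt.clique_succ (h : U.GoodAt n) {q a b : U.W} (hq : U.level q = n + 1)
    (haq : U.A a q) (ha : U.level q = U.level a + 1) (hbq : U.A b q)
    (hb : U.level q = U.level b + 1) : a = b ∨ U.A a b := by
  have := U.chain haq ha hbq hb
  clear hbq hb
  induction this with
  | refl => exact Or.inl rfl
  | tail _ hbc ih =>
    obtain ⟨h1, h2, h3, h4, h5⟩ := hbc
    rcases ih with rfl | ih
    · exact Or.inr h1
    · exact h.parents_trans hG (by omega) (by omega) (by omega) hq haq h2 h3 ih h1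

/-- If `a` lies below `w`, it is a grandparent of `b`, which is excluded. If `a` has level `n`, the
edge from `a` towards `U.p b` has no lift up to level `n`, as such a lift would be adjacent to `w`;
so `a` has a new child there, which gluing along `w, a` identifies with `b`. -/
theorem GoodAt.adj_old_new (h : U.GoodAt n) {w a b : U.W} (hw : U.level w = n) (ha : U.A w a)
    (hb : U.A w b) (hla : U.level a ≤ n) (hlb : U.level b = n + 1)
    (hadj : G.Adj (U.p a) (U.p b)) : U.A a b := by
  have hlw := U.level_le (U.symm ha)
  rcases Nat.lt_or_ge (U.level a) n with hlt | hge
  · exact absurd hadj (h.not_adj_grandparent hw (U.symm ha) (by omega) (by omega) hb)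
  have hfresh : ∀ t, U.A a t → U.level t ≤ U.level a → U.p t ≠ U.p b := by
    intro t hat hlt ht
    have : U.A w t := (h.at_level a (by omega) w t (U.symm ha) hat (by omega) (by omega)).2
      (ht ▸ U.map_adj hb)
    exact U.fresh hb (by omega) this (by omega) ht
  obtain ⟨q, hlq, haq, hq⟩ := U.exists_child hadj hfresh
  have : q = b := U.glue haq hlq hb (by omega) (by omega) (Or.inr (U.symm ha)) hq
  exact this ▸ haq

theorem GoodAt.faithful (h : U.GoodAt n) {w : U.W} (hw : U.level w = n) :
    U.FaithfulAt w fun _ => True := by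
  intro a b ha hb _ _
  have hla := U.level_le ha
  have hlb := U.level_le hb
  rcases Nat.lt_or_ge n (U.level a) with ha' | ha' <;>
    rcases Nat.lt_or_ge n (U.level b) with hb' | hb'
  · exact ⟨fun e => U.glue ha (by omega) hb (by omega) rfl (Or.inl rfl) e,
      fun e => U.adj_of ha hb (by omega) (by omega) e⟩
  · exact ⟨fun e => absurd e.symm (U.fresh ha (by omega) hb (by omega)),
      fun e => U.symm (h.adj_old_new hw hb ha hb' (by omega) e.symm)⟩
  · exact ⟨fun e => absurd e (U.fresh hb (by omega) ha (by omega)),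
      fun e => h.adj_old_new hw ha hb ha' (by omega) e⟩
  · exact h.at_level w hw a b ha hb ha' hb'

include hG in
-- A common parent `w` of `q` and `b` equals `a` or is adjacent to it, since parents of `q` form a
-- clique; the claim is then faithfulness at `w`.
theorem GoodAt.parent_sphere (h : U.GoodAt n) {q a b : U.W} (hq : U.level q = n + 1)
    (ha : U.A q a) (hb : U.A q b) (hla : U.level a = n) (hlb : U.level b = n + 1) :
    U.p a ≠ U.p b ∧ (G.Adj (U.p a) (U.p b) → U.A a b) := by
  obtain ⟨w, hw, hwq, hwb⟩ := U.exists_common_parent hb (by omega)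
  rcases h.clique_succ hG hq (U.symm ha) (by omega) hwq hw with rfl | haw
  · exact ⟨(U.map_adj hwb).ne, fun _ => hwb⟩
  · exact ⟨U.fresh hwb (by omega) (U.symm haw) (by omega),
      (h.faithful (by omega) a b (U.symm haw) hwb trivial trivial).2⟩

include hG in
-- Let `w₁`, `w₂` be common parents of `q` with `a` and with `b`. If they differ, the cycle `a, w₁,
-- w₂, b` around `q` has a diagonal, which lifts by `parent_sphere`. Then `a` and `b` are neighbours
-- of one common parent, where faithfulness is known.
theorem GoodAt.sphere_sphere (h : U.GoodAt n) {q a b : U.W} (hq : U.level q = n + 1)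
    (ha : U.A q a) (hb : U.A q b) (hla : U.level a = n + 1) (hlb : U.level b = n + 1) :
    (U.p a = U.p b → a = b) ∧ (G.Adj (U.p a) (U.p b) → U.A a b) := by
  obtain ⟨w₁, hw₁, hw₁q, hw₁a⟩ := U.exists_common_parent ha (by omega)
  obtain ⟨w₂, hw₂, hw₂q, hw₂b⟩ := U.exists_common_parent hb (by omega)
  have Q₁ := h.faithful (w := w₁) (by omega) a b hw₁a
  have Q₂ := fun ha => h.faithful (w := w₂) (by omega) a b ha hw₂b trivial trivial
  rcases h.clique_succ hG hq hw₁q hw₁ hw₂q hw₂ with rfl | hw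
  · exact Q₂ hw₁a
  have k₁ := h.parent_sphere hG hq (U.symm hw₁q) hb (by omega) hlb
  have k₂ := h.parent_sphere hG hq (U.symm hw₂q) ha (by omega) hla
  have g := @U.map_adj
  refine ⟨fun e => (Q₂ (k₂.2 (e ▸ g hw₂b))).1 e, fun e => ?_⟩
  rcases hG.four (U.p q) (U.p a) (U.p w₁) (U.p w₂) (U.p b) (g ha) (g hw₁q).symm (g hw₂q).symm (g hb)
    (g hw₁a).symm (g hw) (g hw₂b) e.symm k₂.1.symm k₁.1 with e' | e'
  · exact (Q₂ (k₂.2 e'.symm)).2 e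
  · exact (Q₁ (k₁.2 e') trivial trivial).2 e

include hG in
theorem GoodAt.succ (h : U.GoodAt n) : U.GoodAt (n + 1) where
  clique _ _ _ hq ha hla hb hlb := h.clique_succ hG hq ha hla hb hlb
  below w hw := by
    rcases Nat.lt_or_ge (U.level w) n with h' | h'
    exacts [h.below w h', h.faithful (by omega)]
  at_level q hq := by
    intro a b ha hb hla hlb
    have hla' := U.level_le (U.symm ha)
    have hlb' := U.level_le (U.symm hb)
    rcases Nat.lt_or_ge n (U.level a) with ha' | ha' <;>
      rcases Nat.lt_or_ge n (U.level b) with hb' | hb'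
    · exact h.sphere_sphere hG hq ha hb (by omega) (by omega)
    · have := h.parent_sphere hG hq hb ha (by omega) (by omega)
      exact ⟨fun e => absurd e.symm this.1, fun e => U.symm (this.2 e.symm)⟩
    · have := h.parent_sphere hG hq ha hb (by omega) (by omega)
      exact ⟨fun e => absurd e this.1, this.2⟩
    · rcases h.clique_succ hG hq (U.symm ha) (by omega) (U.symm hb) (by omega) with rfl | hab
      · exact ⟨fun _ => rfl, fun e => absurd rfl e.ne⟩
      · exact ⟨fun e => absurd e (U.map_adj hab).ne, fun _ => hab⟩

theorem goodAt_zero : U.GoodAt 0 where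
  clique _ _ _ hq _ hla _ _ := by omega
  below _ hw := absurd hw (Nat.not_lt_zero _)
  at_level w hw := by
    intro a b ha hb hla hlb
    have h1 := U.eq_root (Nat.le_zero.1 hla)
    have h2 := U.eq_root hw
    subst h1 h2
    exact absurd rfl (U.map_adj ha).ne

include hG in
theorem goodAt (n : ℕ) : U.GoodAt n := by
  induction n with
  | zero => exact goodAt_zero
  | succ n ih => exact ih.succ hG

include hG in
theorem eq_of_p_eq {w a b : U.W} (ha : U.A w a) (hb : U.A w b) (h : U.p a = U.p b) : a = b :=
  ((goodAt hG _).faithful rfl a b ha hb trivial trivial).1 h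

include hG in
theorem adj_of_p_adj {w a b : U.W} (ha : U.A w a) (hb : U.A w b) (h : G.Adj (U.p a) (U.p b)) :
    U.A a b :=
  ((goodAt hG _).faithful rfl a b ha hb trivial trivial).2 h

include hG in
theorem parents_clique {q a b : U.W} (ha : U.A a q) (hla : U.level q = U.level a + 1)
    (hb : U.A b q) (hlb : U.level q = U.level b + 1) : a = b ∨ U.A a b :=
  (goodAt hG _).clique q a b rfl ha hla hb hlb

end Unfolding

/-! ### Existence: construction of the unfolding layer by layer. -/

namespace Unfolding

/-- One level of the unfolding: its vertices, their projection, the edges among them, and the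
neighbours of their images that are already realized at this level or the previous one. -/
structure Layer (V : Type v) where
  S : Type v
  p : S → V
  adj : S → S → Prop
  old : S → Set V

namespace Layer

variable {V : Type v} (G : SimpleGraph V) (L : Layer V)

/-- The edges of `G` leading from a layer to new vertices. -/
def Exit : Type v := {c : L.S × V // G.Adj (L.p c.1) c.2 ∧ c.2 ∉ L.old c.1}

variable {G L} in
/-- Exits to the same vertex from adjacent vertices are identified. -/
def Exit.Glue (c d : L.Exit G) : Prop := L.adj c.1.1 d.1.1 ∧ c.1.2 = d.1.2

/-- The vertices of the next layer. -/
def NextS : Type v := Quot (Exit.Glue (G := G) (L := L))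

variable {G L} in
def NextS.p : L.NextS G → V := Quot.lift (fun c : L.Exit G => c.1.2) fun _ _ h => h.2

variable {G L} in
/-- `w` is a parent of `q`. -/
def Parent (w : L.S) (q : L.NextS G) : Prop := ∃ c : L.Exit G, c.1.1 = w ∧ Quot.mk _ c = q

/-- Adjacency in the next layer. -/
def nextAdj (q q' : L.NextS G) : Prop := G.Adj q.p q'.p ∧ ∃ w, Parent w q ∧ Parent w q'

/-- The next layer. -/
def next : Layer V where
  S := L.NextS G
  p := NextS.p
  adj := L.nextAdj G
  old q := {z | (∃ w, Parent w q ∧ L.p w = z) ∨ ∃ q', L.nextAdj G q q' ∧ q'.p = z}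

/-- The bottom layer. -/
def base (x : V) : Layer V where
  S := PUnit
  p _ := x
  adj _ _ := False
  old _ := ∅

variable {G L}

theorem Parent.adj {w : L.S} {q : L.NextS G} (h : Parent w q) : G.Adj (L.p w) q.p := by
  obtain ⟨c, rfl, rfl⟩ := h
  exact c.2.1

theorem Parent.notMem_old {w : L.S} {q : L.NextS G} (h : Parent w q) : q.p ∉ L.old w := by
  obtain ⟨c, rfl, rfl⟩ := h
  exact c.2.2

theorem Parent.eq_of_adj {w w' : L.S} {q q' : L.NextS G} (h : Parent w q) (h' : Parent w' q')
    (hw : w = w' ∨ L.adj w w') (hp : q.p = q'.p) : q = q' := by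
  obtain ⟨c, rfl, rfl⟩ := h
  obtain ⟨d, rfl, rfl⟩ := h'
  rcases hw with hw | hw
  · exact congrArg _ (Subtype.ext (Prod.ext hw hp))
  · exact Quot.sound ⟨hw, hp⟩

/-- Equality in the quotient unwinds to a zigzag of generating identifications, all of whose members
represent `q`. -/
theorem Parent.chain (hL : ∀ a b, L.adj a b → L.adj b a) {w w' : L.S} {q : L.NextS G}
    (h : Parent w q) (h' : Parent w' q) :
    Relation.ReflTransGen (fun a b => L.adj a b ∧ Parent a q ∧ Parent b q) w w' := by
  obtain ⟨c, rfl, rfl⟩ := h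
  obtain ⟨d, rfl, hd⟩ := h'
  have := Quot.eqvGen_exact hd.symm
  induction this with
  | rel a b hab => exact .single ⟨hab.1, ⟨a, rfl, rfl⟩, ⟨b, rfl, hd⟩⟩
  | refl => exact .refl
  | symm a b _ ih =>
    rw [← hd]
    refine (@Relation.ReflTransGen.stdSymm _ _ ⟨fun y z hyz => ?_⟩).symm _ _ (ih hd.symm)
    exact ⟨hL _ _ hyz.1, hyz.2.2, hyz.2.1⟩
  | trans a b c hab _ ih1 ih2 =>
    have : Quot.mk Exit.Glue b = Quot.mk Exit.Glue a := (Quot.eqvGen_sound hab).symm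
    refine (ih1 this).trans ?_
    rw [← this]
    exact ih2 (hd.trans this.symm)

end Layer

variable {V : Type v} (G : SimpleGraph V) (x : V)

/-- The layers of the unfolding. -/
def layer : ℕ → Layer V
  | 0 => Layer.base x
  | n + 1 => (layer n).next G

theorem layer_adj_symm (n : ℕ) (a b : (layer G x n).S) (h : (layer G x n).adj a b) :
    (layer G x n).adj b a := by
  cases n with
  | zero => exact h
  | succ n => exact ⟨h.1.symm, h.2.imp fun _ => And.symm⟩

theorem layer_adj_map (n : ℕ) (a b : (layer G x n).S) (h : (layer G x n).adj a b) :
    G.Adj ((layer G x n).p a) ((layer G x n).p b) := by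
  cases n with
  | zero => exact h.elim
  | succ n => exact h.1

/-- Vertices of the total unfolding. -/
def Total : Type v := Σ n, (layer G x n).S

/-- Adjacency in the total unfolding. -/
inductive Total.Adj : Total G x → Total G x → Prop
  | same (n : ℕ) (a b : (layer G x n).S) (h : (layer G x n).adj a b) : Adj ⟨n, a⟩ ⟨n, b⟩
  | up (n : ℕ) (w : (layer G x n).S) (q : (layer G x n).NextS G) (h : Layer.Parent w q) :
      Adj ⟨n, w⟩ ⟨n + 1, q⟩
  | down (n : ℕ) (w : (layer G x n).S) (q : (layer G x n).NextS G) (h : Layer.Parent w q) :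
      Adj ⟨n + 1, q⟩ ⟨n, w⟩

variable {G x}

theorem Total.Adj.parent {n : ℕ} {w : (layer G x n).S} {q : (layer G x n).NextS G}
    (h : Total.Adj G x ⟨n, w⟩ ⟨n + 1, q⟩) : Layer.Parent w q := by
  cases h
  assumption

theorem Total.Adj.layer_adj {n : ℕ} {a b : (layer G x n).S}
    (h : Total.Adj G x ⟨n, a⟩ ⟨n, b⟩) : (layer G x n).adj a b := by
  cases h
  assumption

theorem Total.Adj.symm {a b : Total G x} (h : Total.Adj G x a b) : Total.Adj G x b a := by
  cases h with
  | same n a b h => exact .same n b a (layer_adj_symm G x n a b h)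
  | up n w q h => exact .down n w q h
  | down n w q h => exact .up n w q h

theorem Total.mem_old {n : ℕ} {w : (layer G x n).S} {z : V} : z ∈ (layer G x n).old w ↔
    ∃ u : Total G x, Total.Adj G x ⟨n, w⟩ u ∧ u.1 ≤ n ∧ (layer G x u.1).p u.2 = z := by
  constructor
  · intro h
    cases n with
    | zero => exact h.elim
    | succ n =>
      rcases h with ⟨u, hu, rfl⟩ | ⟨q, hq, rfl⟩
      · exact ⟨⟨n, u⟩, .down n u w hu, Nat.le_succ n, rfl⟩
      · exact ⟨⟨n + 1, q⟩, .same (n + 1) w q hq, le_rfl, rfl⟩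
  · rintro ⟨u, hu, hle, rfl⟩
    cases hu with
    | same n a b h =>
      cases n with
      | zero => exact h.elim
      | succ n => exact Or.inr ⟨b, h, rfl⟩
    | up n w q h => exact absurd hle (Nat.not_succ_le_self n)
    | down n w q h => exact Or.inl ⟨w, h, rfl⟩

variable (G x)

/-- The unfolding of `G` at `x`. -/
def ofGraph : Unfolding G x where
  W := Total G x
  level := Sigma.fst
  p w := (layer G x w.1).p w.2
  A := Total.Adj G x
  root := ⟨0, PUnit.unit⟩
  symm := Total.Adj.symm
  map_adj h := by
    cases h with
    | same n a b h => exact layer_adj_map G x n a b h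
    | up n w q h => exact h.adj
    | down n w q h => exact h.adj.symm
  level_le h := by cases h <;> simp only <;> omega
  level_root := rfl
  eq_root {w} h := by
    obtain ⟨n, w⟩ := w
    cases h
    rfl
  p_root := rfl
  exists_parent {q} h := by
    obtain ⟨n, q⟩ := q
    cases n with
    | zero => exact absurd rfl h
    | succ n =>
      obtain ⟨c, rfl⟩ := Quot.exists_rep q
      exact ⟨⟨n, c.1.1⟩, rfl, .up n _ _ ⟨c, rfl, rfl⟩⟩
  exists_child {w z} h h' := by
    obtain ⟨n, w⟩ := w
    refine ⟨⟨n + 1, Quot.mk _ ⟨(w, z), h, fun hz => ?_⟩⟩, rfl, .up n _ _ ⟨_, rfl, rfl⟩, rfl⟩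
    obtain ⟨u, hu, hle, hz⟩ := Total.mem_old.1 hz
    exact h' u hu hle hz
  fresh {w q u} hq hl hu hle he := by
    obtain ⟨n, w⟩ := w
    obtain ⟨m, q⟩ := q
    cases hl
    exact hq.parent.notMem_old (Total.mem_old.2 ⟨u, hu, hle, he⟩)
  glue {w q w' q'} h hl h' hl' hww hor hp := by
    obtain ⟨n, w⟩ := w
    obtain ⟨m, q⟩ := q
    obtain ⟨n', w'⟩ := w'
    obtain ⟨m', q'⟩ := q'
    cases hl
    cases hl'
    cases hww
    have hor' : w = w' ∨ (layer G x n).adj w w' :=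
      hor.imp (fun e => by cases e; rfl) Total.Adj.layer_adj
    exact congrArg (Sigma.mk (n + 1)) (h.parent.eq_of_adj h'.parent hor' hp)
  chain {q w w'} h hl h' hl' := by
    obtain ⟨n, w⟩ := w
    obtain ⟨m, q⟩ := q
    obtain ⟨n', w'⟩ := w'
    cases hl
    cases hl'
    refine (h.parent.chain (layer_adj_symm G x n) h'.parent).lift (fun a => (⟨n, a⟩ : Total G x))
      fun a b hab => ?_
    exact ⟨.same n a b hab.1, .up n a q hab.2.1, .up n b q hab.2.2, rfl, rfl⟩
  exists_common_parent {q q'} h hl := by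
    cases h with
    | same n a b h =>
      cases n with
      | zero => exact h.elim
      | succ n =>
        obtain ⟨-, w, hwa, hwb⟩ := h
        exact ⟨⟨n, w⟩, rfl, .up n w a hwa, .up n w b hwb⟩
    | up n w q h => exact absurd hl (Nat.succ_ne_self n).symm
    | down n w q h => exact absurd hl (Nat.succ_ne_self n)
  adj_of {w q q'} h h' hl hl' hadj := by
    obtain ⟨n, w⟩ := w
    obtain ⟨m, q⟩ := q
    obtain ⟨m', q'⟩ := q'
    cases hl
    cases hl'
    exact .same (n + 1) q q' ⟨hadj, w, h.parent, h'.parent⟩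

end Unfolding

namespace PreAbstractSimplicialComplex

/-! ### Short cycles in links of vertices. -/

section Links

variable {V : Type*} {X : PreAbstractSimplicialComplex V}

theorem adj_face_left {a b : V} (h : X.oneSkeleton.Adj a b) : {a} ∈ X.faces := by
  classical
  exact face_singleton h.2 (by simp)

theorem adj_face_right {a b : V} (h : X.oneSkeleton.Adj a b) : {b} ∈ X.faces :=
  adj_face_left h.symm

theorem adj_of_mem_face {σ : Finset V} (hσ : σ ∈ X.faces) {a b : V} (ha : a ∈ σ) (hb : b ∈ σ)
    (hab : a ≠ b) : X.oneSkeleton.Adj a b := by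
  classical
  refine ⟨hab, face_mono hσ ?_ (by simp)⟩
  exact Finset.insert_subset ha (Finset.singleton_subset_iff.2 hb)

/-- The cyclic sequence `a` is a full cycle in the link of the vertex `c`. -/
theorem IsFlag.isFullCycle_link (hX : X.IsFlag) {n : ℕ} {c : V} {a : ZMod n → V}
    (hinj : Function.Injective a) (hc : ∀ i, X.oneSkeleton.Adj c (a i))
    (hadj : ∀ i, X.oneSkeleton.Adj (a i) (a (i + 1)))
    (hfull : ∀ i j, X.oneSkeleton.Adj (a i) (a j) → j = i + 1 ∨ i = j + 1)
    (hn : ∀ S : Finset (ZMod n), (∀ i ∈ S, ∀ j ∈ S, i = j ∨ j = i + 1 ∨ i = j + 1) →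
      ∃ j, ∀ i ∈ S, i = j ∨ i = j + 1) :
    (X.link {c}).IsFullCycle n a := by
  classical
  refine ⟨hinj, fun i => ⟨(hadj i).1, (hadj i).2, ?_, ?_⟩, fun σ hσ hσa => ?_⟩
  · rw [Finset.disjoint_singleton_right]
    simp only [Finset.mem_insert, Finset.mem_singleton, not_or]
    exact ⟨(hc i).ne, (hc (i + 1)).ne⟩
  · refine hX _ (by simp) ?_ ?_
    · intro b hb
      simp only [Finset.mem_union, Finset.mem_insert, Finset.mem_singleton] at hb
      rcases hb with (rfl | rfl) | rfl
      exacts [adj_face_right (hc i), adj_face_right (hc _), adj_face_left (hc i)]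
    · intro b hb d hd hbd
      simp only [Finset.mem_union, Finset.mem_insert, Finset.mem_singleton] at hb hd
      rcases hb with (rfl | rfl) | rfl <;> rcases hd with (rfl | rfl) | rfl
      exacts [absurd rfl hbd, hadj i, (hc i).symm, (hadj i).symm, absurd rfl hbd, (hc _).symm,
        hc i, hc _, absurd rfl hbd]
  · let S : Finset (ZMod n) := σ.preimage a hinj.injOn
    obtain ⟨j, hj⟩ := hn S fun i hi k hk => by
      by_cases hik : i = k
      · exact Or.inl hik
      · exact Or.inr (hfull i k (adj_of_mem_face hσ.1 (Finset.mem_preimage.1 hi)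
          (Finset.mem_preimage.1 hk) (hinj.ne hik)))
    refine ⟨j, fun b hb => ?_⟩
    obtain ⟨i, rfl⟩ := hσa hb
    rcases hj i (Finset.mem_preimage.2 hb) with rfl | rfl
    exacts [Or.inl rfl, Or.inr rfl]

/-- Without a diagonal, the cycle around `c` would be a full cycle of length 4 or 5 in the link of
`c`. -/
theorem IsLocallyLarge.noLocalShortCycle (hX : X.IsLocallyLarge 6) :
    X.oneSkeleton.NoLocalShortCycle where
  four c a₁ a₂ a₃ a₄ h₁ h₂ h₃ h₄ h₁₂ h₂₃ h₃₄ h₄₁ n₁₃ n₂₄ := by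
    by_contra! hcon
    obtain ⟨c₁₃, c₂₄⟩ := hcon
    have c₃₁ := fun h => c₁₃ (SimpleGraph.Adj.symm h)
    have c₄₂ := fun h => c₂₄ (SimpleGraph.Adj.symm h)
    let a : ZMod 4 → V := (![a₁, a₂, a₃, a₄] : Fin 4 → V)
    have := (hX.2 {c} (adj_face_left h₁)).2 4 le_rfl a (hX.1.isFullCycle_link ?_ ?_ ?_ ?_ ?_)
    · omega
    · intro i j hij
      change Fin 4 at i j
      fin_cases i <;> fin_cases j <;>
        first
        | rfl
        | exact absurd hij h₁₂.ne | exact absurd hij h₂₃.ne | exact absurd hij h₃₄.ne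
        | exact absurd hij h₄₁.ne | exact absurd hij h₁₂.ne' | exact absurd hij h₂₃.ne'
        | exact absurd hij h₃₄.ne' | exact absurd hij h₄₁.ne' | exact absurd hij n₁₃
        | exact absurd hij n₂₄ | exact absurd hij n₁₃.symm | exact absurd hij n₂₄.symm
    · intro i
      change Fin 4 at i
      fin_cases i <;> assumption
    · intro i
      change Fin 4 at i
      fin_cases i <;> assumption
    · intro i j hij
      change Fin 4 at i j
      fin_cases i <;> fin_cases j <;>
        first
        | exact absurd rfl hij.ne | exact absurd hij c₁₃ | exact absurd hij c₃₁
        | exact absurd hij c₂₄ | exact absurd hij c₄₂ | exact Or.inl rfl | exact Or.inr rfl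
    -- Residues modulo 4 that are pairwise equal or consecutive lie in some `{j, j + 1}`: a finite
    -- check.
    · decide
  five c a₁ a₂ a₃ a₄ a₅ h₁ h₂ h₃ h₄ h₅ h₁₂ h₂₃ h₃₄ h₄₅ h₅₁ n₁₃ n₁₄ n₂₄ n₂₅ n₃₅ := by
    by_contra! hcon
    obtain ⟨c₁₃, c₁₄, c₂₄, c₂₅, c₃₅⟩ := hcon
    have c₃₁ := fun h => c₁₃ (SimpleGraph.Adj.symm h)
    have c₄₁ := fun h => c₁₄ (SimpleGraph.Adj.symm h)
    have c₄₂ := fun h => c₂₄ (SimpleGraph.Adj.symm h)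
    have c₅₂ := fun h => c₂₅ (SimpleGraph.Adj.symm h)
    have c₅₃ := fun h => c₃₅ (SimpleGraph.Adj.symm h)
    let a : ZMod 5 → V := (![a₁, a₂, a₃, a₄, a₅] : Fin 5 → V)
    have := (hX.2 {c} (adj_face_left h₁)).2 5 (by norm_num) a
      (hX.1.isFullCycle_link ?_ ?_ ?_ ?_ ?_)
    · omega
    · intro i j hij
      change Fin 5 at i j
      fin_cases i <;> fin_cases j <;>
        first
        | rfl
        | exact absurd hij h₁₂.ne | exact absurd hij h₂₃.ne | exact absurd hij h₃₄.ne
        | exact absurd hij h₄₅.ne | exact absurd hij h₅₁.ne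
        | exact absurd hij h₁₂.ne' | exact absurd hij h₂₃.ne'
        | exact absurd hij h₃₄.ne' | exact absurd hij h₄₅.ne' | exact absurd hij h₅₁.ne'
        | exact absurd hij n₁₃ | exact absurd hij n₁₄ | exact absurd hij n₂₄
        | exact absurd hij n₂₅ | exact absurd hij n₃₅
        | exact absurd hij n₁₃.symm | exact absurd hij n₁₄.symm | exact absurd hij n₂₄.symm
        | exact absurd hij n₂₅.symm | exact absurd hij n₃₅.symm
    · intro i
      change Fin 5 at i
      fin_cases i <;> assumption
    · intro i
      change Fin 5 at i
      fin_cases i <;> assumption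
    · intro i j hij
      change Fin 5 at i j
      fin_cases i <;> fin_cases j <;>
        first
        | exact absurd rfl hij.ne | exact absurd hij c₁₃ | exact absurd hij c₃₁
        | exact absurd hij c₁₄ | exact absurd hij c₄₁ | exact absurd hij c₂₅
        | exact absurd hij c₅₂ | exact absurd hij c₃₅ | exact absurd hij c₅₃
        | exact absurd hij c₂₄ | exact absurd hij c₄₂ | exact Or.inl rfl | exact Or.inr rfl
    · decide

end Links

end PreAbstractSimplicialComplex

namespace Unfolding

variable {V : Type v}

/-! ### The flag complex of the unfolding covers `X`. -/

section Complex

variable {X : PreAbstractSimplicialComplex V} {x : V} (U : Unfolding X.oneSkeleton x)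

/-- The flag complex of the unfolding. -/
def complex : PreAbstractSimplicialComplex U.W where
  faces := {σ | σ.Nonempty ∧ ∀ a ∈ σ, ∀ b ∈ σ, a = b ∨ U.A a b}
  isRelLowerSet_faces := fun _ hσ => ⟨hσ.1, fun _ hτ hne =>
    ⟨hne, fun _ ha _ hb => hσ.2 _ (hτ ha) _ (hτ hb)⟩⟩

variable {U}

theorem singleton_mem_complex (w : U.W) : {w} ∈ U.complex.faces :=
  ⟨Finset.singleton_nonempty w, fun _ ha _ hb => Or.inl
    ((Finset.mem_singleton.1 ha).trans (Finset.mem_singleton.1 hb).symm)⟩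

theorem p_mem_faces (hx : {x} ∈ X.faces) (w : U.W) : {U.p w} ∈ X.faces := by
  by_cases h : U.level w = 0
  · rwa [U.eq_root h, U.p_root]
  · obtain ⟨u, -, hu⟩ := U.exists_parent h
    exact PreAbstractSimplicialComplex.adj_face_right (U.map_adj hu)

/-- A simplex through `U.p w` is lifted by lifting its edges at `w`. Reflection of adjacency among
neighbours of `w` makes the lifted vertices span a simplex, and injectivity on these neighbours
makes the lift unique. -/
theorem isSimplicialCovering (hX : X.IsLocallyLarge 6) (hx : {x} ∈ X.faces) :
    U.complex.IsSimplicialCovering X U.p := by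
  classical
  have hG := hX.noLocalShortCycle
  have hinj : ∀ σ ∈ U.complex.faces, Set.InjOn U.p σ := fun σ hσ a ha b hb hab =>
    (hσ.2 a ha b hb).resolve_right fun h => (U.map_adj h).ne hab
  constructor
  · intro σ hσ
    refine hX.1 _ (hσ.1.image _) (fun a ha => ?_) fun a ha b hb hab => ?_
    · obtain ⟨w, -, rfl⟩ := Finset.mem_image.1 ha
      exact p_mem_faces hx w
    · obtain ⟨w, hw, rfl⟩ := Finset.mem_image.1 ha
      obtain ⟨u, hu, rfl⟩ := Finset.mem_image.1 hb
      exact U.map_adj ((hσ.2 w hw u hu).resolve_left fun h => hab (congrArg U.p h))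
  · exact hinj
  · intro w _ σ hσ hwσ
    have : ∀ z : V, ∃ u, z ∈ σ → U.p u = z ∧ (z = U.p w ∧ u = w ∨ z ≠ U.p w ∧ U.A w u) := by
      intro z
      by_cases hz : z ∈ σ
      · by_cases hzw : z = U.p w
        · exact ⟨w, fun _ => ⟨hzw.symm, Or.inl ⟨hzw, rfl⟩⟩⟩
        · obtain ⟨u, hu, hu'⟩ := U.exists_lift
            (PreAbstractSimplicialComplex.adj_of_mem_face hσ hwσ hz (Ne.symm hzw))
          exact ⟨u, fun _ => ⟨hu', Or.inr ⟨hzw, hu⟩⟩⟩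
      · exact ⟨w, fun h => absurd h hz⟩
    choose g hg using this
    refine ⟨σ.image g, ⟨⟨g (U.p w), Finset.mem_image_of_mem _ hwσ⟩, ?_⟩, ?_, ?_⟩
    · intro a ha b hb
      obtain ⟨y, hy, rfl⟩ := Finset.mem_image.1 ha
      obtain ⟨z, hz, rfl⟩ := Finset.mem_image.1 hb
      by_cases hyz : y = z
      · exact Or.inl (congrArg g hyz)
      right
      obtain ⟨hy1, ⟨hy2, hy3⟩ | ⟨hy2, hy3⟩⟩ := hg y hy <;>
        obtain ⟨hz1, ⟨hz2, hz3⟩ | ⟨hz2, hz3⟩⟩ := hg z hz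
      · exact absurd (hy2.trans hz2.symm) hyz
      · rwa [hy3]
      · rw [hz3]; exact U.symm hy3
      · refine adj_of_p_adj hG hy3 hz3 ?_
        rw [hy1, hz1]
        exact PreAbstractSimplicialComplex.adj_of_mem_face hσ hy hz hyz
    · obtain ⟨-, ⟨-, h⟩ | ⟨h, -⟩⟩ := hg (U.p w) hwσ
      · exact Finset.mem_image.2 ⟨U.p w, hwσ, h⟩
      · exact absurd rfl h
    · rw [Finset.image_image]
      refine (Finset.image_congr fun z hz => ?_).trans Finset.image_id
      exact (hg z hz).1
  · have key : ∀ τ ∈ U.complex.faces, ∀ τ' ∈ U.complex.faces, ∀ w ∈ τ, w ∈ τ' →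
        τ.image U.p = τ'.image U.p → τ ⊆ τ' := by
      intro τ hτ τ' hτ' w hw hw' he a ha
      obtain ⟨b, hb, hab⟩ := Finset.mem_image.1 (he ▸ Finset.mem_image_of_mem U.p ha)
      rcases hτ.2 w hw a ha with rfl | hwa
      · exact hw'
      rcases hτ'.2 w hw' b hb with rfl | hwb
      · exact absurd hab (U.map_adj hwa).ne
      · exact eq_of_p_eq hG hwa hwb hab.symm ▸ hb
    exact fun τ hτ τ' hτ' w hw hw' he =>
      (key τ hτ τ' hτ' w hw hw' he).antisymm (key τ' hτ' τ hτ w hw' hw he.symm)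

theorem pathConnected : PathConnectedSpace U.complex.Realization := by
  classical
  refine PreAbstractSimplicialComplex.pathConnectedSpace_of_chain (singleton_mem_complex U.root)
    fun w _ => ?_
  induction h : U.level w generalizing w with
  | zero => rw [U.eq_root h]
  | succ n ih =>
    obtain ⟨u, hu, huw⟩ := U.exists_parent (q := w) (by omega)
    refine (ih u (singleton_mem_complex u) (by omega)).tail ⟨by simp, fun a ha b hb => ?_⟩
    simp only [Finset.mem_insert, Finset.mem_singleton] at ha hb
    rcases ha with rfl | rfl <;> rcases hb with rfl | rfl
    exacts [Or.inl rfl, Or.inr huw, Or.inr (U.symm huw), Or.inl rfl]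

/-- This is where simple connectivity of `X` enters. -/
theorem p_injective (hX : X.IsSystolic) (hx : {x} ∈ X.faces) : Function.Injective U.p :=
  fun w w' h =>
    have := hX.1
    have := U.pathConnected
    (isSimplicialCovering hX.2 hx).injOn_vertices (singleton_mem_complex w)
      (singleton_mem_complex w') h

end Complex

/-! ### Levels are distances. -/

section Distance

variable {G : SimpleGraph V} {x : V} {U : Unfolding G x}

theorem exists_lift_walk {v y : V} (γ : G.Walk v y) (w : U.W) (hw : U.p w = v) :
    ∃ u, U.p u = y ∧ U.level u ≤ U.level w + γ.length := by
  induction γ generalizing w with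
  | nil => exact ⟨w, hw, Nat.le_add_right _ _⟩
  | cons h γ ih =>
    obtain ⟨u, hwu, hu⟩ := U.exists_lift (hw ▸ h)
    obtain ⟨t, ht, hlt⟩ := ih u hu
    have := U.level_le hwu
    exact ⟨t, ht, by rw [SimpleGraph.Walk.length_cons]; omega⟩

theorem exists_walk (w : U.W) : ∃ γ : G.Walk x (U.p w), γ.length = U.level w := by
  induction h : U.level w generalizing w with
  | zero => rw [U.eq_root h, U.p_root]; exact ⟨.nil, rfl⟩
  | succ n ih =>
    obtain ⟨u, hu, huw⟩ := U.exists_parent (q := w) (by omega)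
    obtain ⟨γ, hγ⟩ := ih u (by omega)
    exact ⟨γ.append (.cons (U.map_adj huw) .nil), by
      rw [SimpleGraph.Walk.length_append, hγ]; rfl⟩

theorem exists_p_eq {v : V} (h : G.Reachable x v) : ∃ w, U.p w = v := by
  obtain ⟨γ⟩ := h
  obtain ⟨u, hu, -⟩ := exists_lift_walk γ U.root U.p_root
  exact ⟨u, hu⟩

/-- Following parents down to the root gives a walk of length the level. Conversely a geodesic lifts
from the root, gaining at most one level per step, and injectivity forces the lift to end at `w`. -/
theorem dist_p (hinj : Function.Injective U.p) (w : U.W) : G.dist x (U.p w) = U.level w := by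
  obtain ⟨γ, hγ⟩ := exists_walk w
  refine le_antisymm ((SimpleGraph.dist_le γ).trans_eq hγ) ?_
  obtain ⟨δ, hδ⟩ := γ.reachable.exists_walk_length_eq_dist
  obtain ⟨u, hu, hlu⟩ := exists_lift_walk δ U.root U.p_root
  rw [hinj hu, U.level_root, zero_add, hδ] at hlu
  exact hlu

end Distance

end Unfolding

namespace PreAbstractSimplicialComplex

variable {V : Type v} {X : PreAbstractSimplicialComplex V}

theorem reachable_of_adj_of_dist {G : SimpleGraph V} {x v : V} {n : ℕ} (h : G.dist x v = n + 1) :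
    G.Reachable x v := by
  by_contra h'
  rw [SimpleGraph.dist_eq_zero_of_not_reachable h'] at h
  omega

theorem IsSystolic.adj_lift (hX : X.IsSystolic) {x : V} (hx : {x} ∈ X.faces)
    (U : Unfolding X.oneSkeleton x) {a b : U.W} (h : X.oneSkeleton.Adj (U.p a) (U.p b)) :
    U.A a b := by
  obtain ⟨u, hau, hu⟩ := U.exists_lift h
  exact Unfolding.p_injective hX hx hu ▸ hau

/-- Edge condition: adjacent vertices of a sphere have a common neighbour closer to the centre. -/
theorem IsSystolic.exists_common_closer (hX : X.IsSystolic) {x : V} (hx : {x} ∈ X.faces)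
    {a b : V} {n : ℕ} (hab : X.oneSkeleton.Adj a b) (ha : X.oneSkeleton.dist x a = n + 1)
    (hb : X.oneSkeleton.dist x b = n + 1) :
    ∃ c, X.oneSkeleton.dist x c = n ∧ X.oneSkeleton.Adj c a ∧ X.oneSkeleton.Adj c b := by
  let U := Unfolding.ofGraph X.oneSkeleton x
  have hinj : Function.Injective U.p := Unfolding.p_injective hX hx
  obtain ⟨a, rfl⟩ := Unfolding.exists_p_eq (U := U) (reachable_of_adj_of_dist ha)
  obtain ⟨b, rfl⟩ := Unfolding.exists_p_eq (U := U) (reachable_of_adj_of_dist hb)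
  rw [Unfolding.dist_p hinj] at ha hb
  obtain ⟨c, hc, hca, hcb⟩ := U.exists_common_parent (hX.adj_lift hx U hab) (by omega)
  exact ⟨U.p c, by rw [Unfolding.dist_p hinj]; omega, U.map_adj hca, U.map_adj hcb⟩

/-- Vertex condition: the neighbours of a vertex closer to the centre are pairwise adjacent. -/
theorem IsSystolic.closer_clique (hX : X.IsSystolic) {x : V} (hx : {x} ∈ X.faces)
    {q a b : V} {n : ℕ} (hq : X.oneSkeleton.dist x q = n + 1) (haq : X.oneSkeleton.Adj a q)
    (hbq : X.oneSkeleton.Adj b q) (ha : X.oneSkeleton.dist x a = n)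
    (hb : X.oneSkeleton.dist x b = n) (hab : a ≠ b) : X.oneSkeleton.Adj a b := by
  let U := Unfolding.ofGraph X.oneSkeleton x
  have hinj : Function.Injective U.p := Unfolding.p_injective hX hx
  have hr := reachable_of_adj_of_dist hq
  obtain ⟨a, rfl⟩ := Unfolding.exists_p_eq (U := U) (hr.trans haq.symm.reachable)
  obtain ⟨b, rfl⟩ := Unfolding.exists_p_eq (U := U) (hr.trans hbq.symm.reachable)
  obtain ⟨q, rfl⟩ := Unfolding.exists_p_eq (U := U) hr
  rw [Unfolding.dist_p hinj] at ha hb hq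
  rcases Unfolding.parents_clique hX.2.noLocalShortCycle (hX.adj_lift hx U haq) (by omega)
    (hX.adj_lift hx U hbq) (by omega) with h | h
  · exact absurd (congrArg U.p h) hab
  · exact U.map_adj h

end PreAbstractSimplicialComplex

namespace PreAbstractSimplicialComplex

/-! ### From the edge and vertex conditions to weak systolicity. -/

section WeaklySystolic

variable {V : Type v} {X : PreAbstractSimplicialComplex V}

theorem dist_of_edist_eq {G : SimpleGraph V} {x w : V} {n : ℕ} (h : G.edist x w = n) :
    G.dist x w = n := by
  rw [SimpleGraph.dist, h, ENat.toNat_natCast]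

theorem IsSystolic.exists_closer (hX : X.IsSystolic) {x : V} (hx : {x} ∈ X.faces)
    {q : V} {n : ℕ} (hq : X.oneSkeleton.dist x q = n + 1) :
    ∃ c, X.oneSkeleton.dist x c = n ∧ X.oneSkeleton.Adj c q := by
  let U := Unfolding.ofGraph X.oneSkeleton x
  have hinj : Function.Injective U.p := Unfolding.p_injective hX hx
  obtain ⟨q, rfl⟩ := Unfolding.exists_p_eq (U := U) (reachable_of_adj_of_dist hq)
  rw [Unfolding.dist_p hinj] at hq
  obtain ⟨c, hc, hcq⟩ := U.exists_parent (q := q) (by omega)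
  exact ⟨U.p c, by rw [Unfolding.dist_p hinj]; omega, U.map_adj hcq⟩

theorem IsSystolic.weakSimpleDescent (hX : X.IsSystolic) (hfin : X.NoInfiniteClique) (n : ℕ)
    {x : V} (hx : {x} ∈ X.faces) : X.WeakSimpleDescent n x := by
  classical
  intro i _ _
  refine ⟨fun e he hcard => ?_, fun w hw => ?_⟩
  · obtain ⟨a, b, hab, rfl⟩ := Finset.card_eq_two.1 hcard
    have hadj : X.oneSkeleton.Adj a b := adj_of_mem_face he.1 (by simp) (by simp) hab
    have ha := dist_of_edist_eq (he.2 (show a ∈ (({a, b} : Finset V) : Set V) by simp))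
    have hb := dist_of_edist_eq (he.2 (show b ∈ (({a, b} : Finset V) : Set V) by simp))
    obtain ⟨c, hc, hca, hcb⟩ := hX.exists_common_closer hx hadj ha hb
    have hr := (reachable_of_adj_of_dist ha).trans hca.symm.reachable
    have hcX := adj_face_left hca
    refine ⟨{c}, ⟨hcX, ?_, ?_⟩, hcX, ?_⟩
    · rw [Finset.disjoint_singleton_left]
      simp only [Finset.mem_insert, Finset.mem_singleton, not_or]
      exact ⟨hca.ne, hcb.ne⟩
    · refine hX.2.1 _ (by simp) (fun y hy => ?_) fun y hy z hz hyz => ?_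
      · simp only [Finset.mem_union, Finset.mem_insert, Finset.mem_singleton] at hy
        rcases hy with rfl | rfl | rfl
        exacts [hcX, adj_face_right hca, adj_face_right hcb]
      · simp only [Finset.mem_union, Finset.mem_insert, Finset.mem_singleton] at hy hz
        rcases hy with rfl | rfl | rfl <;> rcases hz with rfl | rfl | rfl
        exacts [absurd rfl hyz, hca, hcb, hca.symm, absurd rfl hyz, hadj, hcb.symm, hadj.symm,
          absurd rfl hyz]
    · intro y hy
      rw [Finset.coe_singleton, Set.mem_singleton_iff] at hy
      subst hy
      change X.oneSkeleton.edist x y ≤ i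
      rw [← hr.coe_dist_eq_edist, hc]
  · have hdw := dist_of_edist_eq (hw.2 (show w ∈ (({w} : Finset V) : Set V) by simp))
    have hrw := reachable_of_adj_of_dist hdw
    -- The simplex of the vertex condition consists of all neighbours of `w` on the previous sphere:
    -- they form a clique, hence a finite set.
    have hS : {a | X.oneSkeleton.dist x a = i ∧ X.oneSkeleton.Adj a w}.Finite :=
      hfin _ fun a ha b hb hab => hX.closer_clique hx hdw ha.2 hb.2 ha.1 hb.1 hab
    have hmem : ∀ {a}, a ∈ hS.toFinset ↔
        X.oneSkeleton.dist x a = i ∧ X.oneSkeleton.Adj a w := fun {a} => hS.mem_toFinset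
    have hclique : ∀ a ∈ hS.toFinset, ∀ b ∈ hS.toFinset, a ≠ b → X.oneSkeleton.Adj a b :=
      fun a ha b hb hab => hX.closer_clique hx hdw (hmem.1 ha).2 (hmem.1 hb).2 (hmem.1 ha).1
        (hmem.1 hb).1 hab
    obtain ⟨c, hc, hcw⟩ := hX.exists_closer hx hdw
    have hne : hS.toFinset.Nonempty := ⟨c, hmem.2 ⟨hc, hcw⟩⟩
    have hface : hS.toFinset ∈ X.faces :=
      hX.2.1 _ hne (fun a ha => adj_face_left (hmem.1 ha).2) hclique
    refine ⟨hS.toFinset, ⟨⟨hface, ?_, ?_⟩, hface, ?_⟩, fun ρ hρ a ha => ?_⟩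
    · rw [Finset.disjoint_singleton_right]
      exact fun h => (hmem.1 h).2.ne rfl
    · refine hX.2.1 _ (hne.mono Finset.subset_union_left) (fun y hy => ?_) fun y hy z hz hyz => ?_
      · rw [Finset.mem_union, Finset.mem_singleton] at hy
        rcases hy with hy | rfl
        exacts [adj_face_left (hmem.1 hy).2, hw.1]
      · rw [Finset.mem_union, Finset.mem_singleton] at hy hz
        rcases hy with hy | rfl <;> rcases hz with hz | rfl
        exacts [hclique y hy z hz hyz, (hmem.1 hy).2, (hmem.1 hz).2.symm, absurd rfl hyz]
    · intro y hy
      have hy := hmem.1 hy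
      change X.oneSkeleton.edist x y ≤ i
      rw [← (hrw.trans hy.2.symm.reachable).coe_dist_eq_edist, hy.1]
    · have haw : a ≠ w := fun h => Finset.disjoint_left.1 hρ.1.2.1 ha (by simp [h])
      have hadj : X.oneSkeleton.Adj a w :=
        adj_of_mem_face hρ.1.2.2 (Finset.mem_union_left _ ha) (by simp) haw
      have hle : X.oneSkeleton.edist x a ≤ i := hρ.2.2 ha
      rw [← (hrw.trans hadj.symm.reachable).coe_dist_eq_edist, Nat.cast_le] at hle
      -- A neighbour of `w` has distance at least `i` by the triangle inequality, so a point of the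
      -- link in the ball lies exactly on the sphere of radius `i`.
      have hge := (SimpleGraph.Walk.reachable (.cons hadj .nil)).dist_triangle_right x
      rw [SimpleGraph.dist_eq_one_iff_adj.2 hadj] at hge
      exact hmem.2 ⟨by omega, hadj⟩

theorem IsSystolic.isWeaklySystolic (hX : X.IsSystolic) (hfin : X.NoInfiniteClique) :
    X.IsWeaklySystolic :=
  have := hX.1
  ⟨inferInstance, hX.2.1, fun n _ hx => hX.weakSimpleDescent hfin n hx⟩

end WeaklySystolic

/-! ### Cocompact actions force finite dimension. -/

section Cocompact

variable {V : Type v} {X : PreAbstractSimplicialComplex V}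

theorem IsFlag.noInfiniteClique (hX : X.IsFlag) (hd : X.IsFiniteDimensional) :
    X.NoInfiniteClique := by
  obtain ⟨d, hd⟩ := hd
  intro S hS
  by_contra hinf
  -- One vertex more than allowed; being at least two, they all lie on edges and so are vertices of
  -- `X`, as flagness requires.
  obtain ⟨σ, hσS, hσ⟩ := Set.Infinite.exists_subset_card_eq hinf (d + 2)
  have hadj : ∀ a ∈ σ, ∀ b ∈ σ, a ≠ b → X.oneSkeleton.Adj a b :=
    fun a ha b hb hab => hS (hσS ha) (hσS hb) hab
  have hface : σ ∈ X.faces := by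
    refine hX σ (Finset.card_pos.1 (by omega)) (fun a ha => ?_) hadj
    obtain ⟨b, hb, hba⟩ := Finset.exists_mem_ne (show 1 < σ.card by omega) a
    exact adj_face_left (hadj a ha b hb hba.symm)
  have := hd σ hface
  omega

/-- The reciprocal of the squared Euclidean length of the vector of barycentric coordinates. -/
def spread (p : X.Realization) : ℝ := (p.1.sum fun _ t => t ^ 2)⁻¹

theorem continuous_spread : Continuous (spread : X.Realization → ℝ) := by
  refine realization_continuous_iff.2 fun σ _ => ?_
  have h : ∀ p : X.FaceSpace σ, (p.incl.1.sum fun _ t => t ^ 2) = ∑ w ∈ σ, p.incl.1 w ^ 2 :=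
    fun p => Finsupp.sum_of_support_subset _ p.support_subset _ (fun _ _ => by simp)
  simp only [spread, h]
  refine Continuous.inv₀ (continuous_finsetSum _ fun w _ => (FaceSpace.continuous_coord w).pow 2)
    fun p => ?_
  obtain ⟨w, hw⟩ := face_nonempty p.incl.2.1
  exact (Finset.sum_pos' (fun _ _ => sq_nonneg _)
    ⟨w, p.support_subset hw, pow_pos (p.incl.pos_of_mem hw) 2⟩).ne'

theorem spread_smul (g : X.Aut) (p : X.Realization) : spread (g • p) = spread p :=
  congrArg (fun t : ℝ => t⁻¹) (Finsupp.sum_equivMapDomain g.1 p.1 fun _ t => t ^ 2)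

/-- At the barycentre of a simplex with `k` vertices the squares sum to k · k⁻² = k⁻¹. -/
theorem exists_spread_eq_card {σ : Finset V} (hσ : σ ∈ X.faces) :
    ∃ p : X.Realization, spread p = σ.card := by
  classical
  have hpos : (0 : ℝ) < σ.card := Nat.cast_pos.2 (Finset.card_pos.2 (face_nonempty hσ))
  let q : V →₀ ℝ := Finsupp.indicator σ fun _ _ => (σ.card : ℝ)⁻¹
  have hq : ∀ w ∈ σ, q w = (σ.card : ℝ)⁻¹ := fun w hw => Finsupp.indicator_of_mem hw _
  have hsub : q.support ⊆ σ := Finsupp.support_indicator_subset _ _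
  have hsum : q.sum (fun _ t => t) = 1 := by
    rw [Finsupp.sum_of_support_subset _ hsub _ (fun _ _ => rfl), Finset.sum_congr rfl hq,
      Finset.sum_const, nsmul_eq_mul, mul_inv_cancel₀ hpos.ne']
  refine ⟨⟨q, face_mono hσ hsub (support_nonempty_of_sum hsum), fun w => ?_, hsum⟩, ?_⟩
  · by_cases hw : w ∈ σ
    · rw [hq w hw]; positivity
    · rw [Finsupp.notMem_support_iff.1 fun h => hw (hsub h)]
  · change (q.sum fun _ t => t ^ 2)⁻¹ = _
    rw [Finsupp.sum_of_support_subset _ hsub _ (fun _ _ => by simp),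
      Finset.sum_congr rfl fun w hw => by rw [hq w hw], Finset.sum_const, nsmul_eq_mul]
    field_simp

/-- A complex with a cocompact action is finite dimensional. -/
theorem ActsGeometrically.isFiniteDimensional {G : Type u} [Group G] {φ : G →* X.Aut}
    (h : X.ActsGeometrically φ) : X.IsFiniteDimensional := by
  let _ : MulAction G X.Realization := MulAction.compHom X.Realization φ
  have : CompactSpace (Quotient (MulAction.orbitRel G X.Realization)) := h.2
  let s : Quotient (MulAction.orbitRel G X.Realization) → ℝ :=
    Quotient.lift spread fun p q hpq => by
      obtain ⟨g, rfl⟩ := MulAction.orbitRel_apply.1 hpq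
      exact spread_smul (φ g) q
  have hs : Continuous s := continuous_spread.quotient_lift _
  obtain ⟨C, hC⟩ := (isCompact_range hs).bddAbove
  refine ⟨⌈C⌉₊, fun σ hσ => ?_⟩
  obtain ⟨p, hp⟩ := exists_spread_eq_card hσ
  have h1 : (σ.card : ℝ) ≤ C := hp ▸ hC ⟨Quotient.mk _ p, rfl⟩
  have h2 := h1.trans (Nat.le_ceil C)
  exact (Nat.cast_le.1 h2).trans (Nat.le_succ _)

end Cocompact

end PreAbstractSimplicialComplex

namespace SimpleGraph

/-! ### Well-orders on spheres and the parent map. -/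

section Parent

variable {V : Type v} (G : SimpleGraph V) (x : V)

/-- The neighbours of `w` at distance `n` from `x`. -/
def neighborsAt (n : ℕ) (w : V) : Set V := {c | G.dist x c = n ∧ G.Adj c w}

open Classical in
/-- The least element of `neighborsAt` for the well-order `r`. -/
def leastNeighbor (r : {r : V → V → Prop // IsWellOrder V r}) (n : ℕ) (w : V) : V :=
  -- The default `x` makes the base vertex its own parent.
  if h : (G.neighborsAt x n w).Nonempty then r.2.wf.min _ h else x

/-- Well-orders on the vertices: vertices are compared by their least neighbours on the previous
sphere first. -/
def sphereOrder : ℕ → {r : V → V → Prop // IsWellOrder V r}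
  | 0 => ⟨WellOrderingRel, inferInstance⟩
  | n + 1 =>
    let f : V → V × V := fun w => (G.leastNeighbor x (sphereOrder n) n w, w)
    ⟨f ⁻¹'o Prod.Lex (sphereOrder n).1 WellOrderingRel, by
      have := (sphereOrder n).2
      exact RelEmbedding.isWellOrder (s := Prod.Lex (sphereOrder n).1 WellOrderingRel)
        (⟨⟨f, fun a b h => (Prod.mk.inj h).2⟩, Iff.rfl⟩ :
          (f ⁻¹'o Prod.Lex (sphereOrder n).1 WellOrderingRel) ↪r _)⟩

/-- The parent of `w`: its least neighbour on the previous sphere. -/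
def parent (w : V) : V :=
  G.leastNeighbor x (G.sphereOrder x (G.dist x w - 1)) (G.dist x w - 1) w

variable {G x}

theorem parent_mem {w : V} {n : ℕ} (h : G.dist x w = n + 1)
    (hne : (G.neighborsAt x n w).Nonempty) : G.parent x w ∈ G.neighborsAt x n w := by
  have : G.dist x w - 1 = n := by omega
  rw [parent, this, leastNeighbor, dif_pos hne]
  exact WellFounded.min_mem _ _ hne

theorem not_lt_parent {w c : V} {n : ℕ} (h : G.dist x w = n + 1)
    (hc : c ∈ G.neighborsAt x n w) : ¬ (G.sphereOrder x n).1 c (G.parent x w) := by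
  have : G.dist x w - 1 = n := by omega
  rw [parent, this, leastNeighbor, dif_pos ⟨c, hc⟩]
  exact WellFounded.not_lt_min _ _ hc

theorem parent_lt_or_eq {a b : V} {n : ℕ} (ha : G.dist x a = n + 1) (hb : G.dist x b = n + 1)
    (h : (G.sphereOrder x (n + 1)).1 a b) :
    (G.sphereOrder x n).1 (G.parent x a) (G.parent x b) ∨ G.parent x a = G.parent x b := by
  have ha' : G.dist x a - 1 = n := by omega
  have hb' : G.dist x b - 1 = n := by omega
  rw [parent, parent, ha', hb']
  rcases Prod.lex_def.1 h with h | h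
  exacts [Or.inl h, Or.inr h.1]

theorem lt_of_not_lt_of_ne {a b : V} {n : ℕ} (h : ¬ (G.sphereOrder x n).1 b a) (hne : a ≠ b) :
    (G.sphereOrder x n).1 a b := by
  have := (G.sphereOrder x n).2
  rcases trichotomous_of (G.sphereOrder x n).1 a b with h' | h' | h'
  exacts [h', absurd h' hne, absurd h' h]

theorem asymm_sphereOrder {a b : V} {n : ℕ} (h : (G.sphereOrder x n).1 a b) :
    ¬ (G.sphereOrder x n).1 b a := by
  have := (G.sphereOrder x n).2
  exact asymm_of _ h

theorem dist_le_of_adj {a b : V} (hab : G.Adj a b) : G.dist x b ≤ G.dist x a + 1 := by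
  have := hab.reachable.dist_triangle_right x
  rwa [SimpleGraph.dist_eq_one_iff_adj.2 hab] at this

variable (G x) in
-- Distance first, then the well-order of the sphere. Choosing the mass to be moved requires one
-- linear order on all vertices.
theorem exists_linearOrder : ∃ L : LinearOrder V, ∀ a b, L.lt a b →
    G.dist x a < G.dist x b ∨
      G.dist x a = G.dist x b ∧ (G.sphereOrder x (G.dist x a)).1 a b := by
  classical
  let r : V → V → Prop := fun a b => G.dist x a < G.dist x b ∨
      G.dist x a = G.dist x b ∧ (G.sphereOrder x (G.dist x a)).1 a b
  have hwo := fun n => (G.sphereOrder x n).2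
  have hr : IsStrictTotalOrder V r :=
    { trichotomous := fun a b hab hba => by
        rcases lt_trichotomy (G.dist x a) (G.dist x b) with h | h | h
        · exact absurd (Or.inl h) hab
        · by_contra hne
          refine hab (Or.inr ⟨h, lt_of_not_lt_of_ne (fun h' => hba (Or.inr ⟨h.symm, ?_⟩)) hne⟩)
          rwa [← h]
        · exact absurd (Or.inl h) hba
      irrefl := fun a h => by
        rcases h with h | h
        · exact lt_irrefl _ h
        · exact asymm_sphereOrder h.2 h.2
      trans := fun a b c hab hbc => by
        rcases hab with hab | hab <;> rcases hbc with hbc | hbc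
        · exact Or.inl (hab.trans hbc)
        · exact Or.inl (hab.trans_eq hbc.1)
        · exact Or.inl (hab.1.trans_lt hbc)
        · refine Or.inr ⟨hab.1.trans hbc.1, ?_⟩
          have := hwo (G.dist x a)
          exact trans_of (G.sphereOrder x (G.dist x a)).1 hab.2 (hab.1 ▸ hbc.2) }
  exact ⟨linearOrderOfSTO r, fun a b h => h⟩

end Parent

end SimpleGraph

namespace PreAbstractSimplicialComplex

/-! ### The parent map preserves nearness. -/

variable {V : Type v} {X : PreAbstractSimplicialComplex V}

/-- `a` and `b` are equal or adjacent. -/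
def Near (X : PreAbstractSimplicialComplex V) (a b : V) : Prop := a = b ∨ X.oneSkeleton.Adj a b

theorem Near.symm {a b : V} (h : X.Near a b) : X.Near b a := h.imp Eq.symm SimpleGraph.Adj.symm

theorem IsFlag.mem_of_near (hX : X.IsFlag) {σ : Finset V} (hne : σ.Nonempty)
    (h : ∀ a ∈ σ, {a} ∈ X.faces) (hnear : ∀ a ∈ σ, ∀ b ∈ σ, X.Near a b) : σ ∈ X.faces :=
  hX σ hne h fun a ha b hb hab => (hnear a ha b hb).resolve_left hab

namespace IsSystolic

variable {x : V} (hX : X.IsSystolic) (hx : {x} ∈ X.faces)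

include hX hx in
theorem reachable {w : V} (hw : {w} ∈ X.faces) : X.oneSkeleton.Reachable x w := by
  have := hX.1
  refine mem_of_closed_under_edges (C := {w | X.oneSkeleton.Reachable x w}) hx
    (SimpleGraph.Reachable.refl x) (fun a b hab ha => ?_) hw
  by_cases h : a = b
  · exact h ▸ ha
  · exact SimpleGraph.Reachable.trans ha (SimpleGraph.Adj.reachable (G := X.oneSkeleton) ⟨h, hab⟩)

include hX hx in
theorem eq_of_dist_eq_zero {w : V} (hw : {w} ∈ X.faces) (h : X.oneSkeleton.dist x w = 0) :
    w = x :=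
  ((hX.reachable hx hw).dist_eq_zero_iff.1 h).symm

include hX hx in
theorem parent_spec {w : V} {n : ℕ} (h : X.oneSkeleton.dist x w = n + 1) :
    X.oneSkeleton.dist x (X.oneSkeleton.parent x w) = n ∧
      X.oneSkeleton.Adj (X.oneSkeleton.parent x w) w :=
  SimpleGraph.parent_mem h (hX.exists_closer hx h)

include hX hx in
theorem near_of_closer {q a b : V} {n : ℕ} (hq : X.oneSkeleton.dist x q = n + 1)
    (ha : a ∈ X.oneSkeleton.neighborsAt x n q) (hb : b ∈ X.oneSkeleton.neighborsAt x n q) :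
    X.Near a b :=
  or_iff_not_imp_left.2 fun h => hX.closer_clique hx hq ha.2 hb.2 ha.1 hb.1 h

include hX hx in
theorem dist_parent (w : V) :
    X.oneSkeleton.dist x (X.oneSkeleton.parent x w) = X.oneSkeleton.dist x w - 1 := by
  cases h : X.oneSkeleton.dist x w with
  | zero =>
    rw [SimpleGraph.parent, h, SimpleGraph.leastNeighbor]
    split_ifs with h'
    · exact (WellFounded.min_mem _ _ h').1
    · exact SimpleGraph.dist_self
  | succ n => exact (hX.parent_spec hx h).1

include hX hx in
/-- Parents of adjacent vertices on a sphere are equal or adjacent, and the parent of the later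
one is adjacent to the earlier one. -/
theorem parent_sphere {n : ℕ} {a b : V} (ha : X.oneSkeleton.dist x a = n)
    (hb : X.oneSkeleton.dist x b = n) (hab : X.oneSkeleton.Adj a b) :
    X.Near (X.oneSkeleton.parent x a) (X.oneSkeleton.parent x b) ∧
      ((X.oneSkeleton.sphereOrder x n).1 a b →
        X.oneSkeleton.Adj (X.oneSkeleton.parent x b) a) := by
  have hG := hX.2.noLocalShortCycle
  induction n generalizing a b with
  | zero =>
    exact absurd ((hX.eq_of_dist_eq_zero hx (adj_face_left hab) ha).trans
      (hX.eq_of_dist_eq_zero hx (adj_face_right hab) hb).symm) hab.ne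
  | succ n ih =>
    obtain ⟨c, hc, hca, hcb⟩ := hX.exists_common_closer hx hab ha hb
    obtain ⟨hα, hαa⟩ := hX.parent_spec hx ha
    obtain ⟨hβ, hβb⟩ := hX.parent_spec hx hb
    set α := X.oneSkeleton.parent x a
    set β := X.oneSkeleton.parent x b
    have hαc : X.Near α c := hX.near_of_closer hx ha ⟨hα, hαa⟩ ⟨hc, hca⟩
    have hβc : X.Near β c := hX.near_of_closer hx hb ⟨hβ, hβb⟩ ⟨hc, hcb⟩
    have haβ : a ≠ β := fun h => by rw [← h] at hβ; omega
    have hαb : α ≠ b := fun h => by rw [h] at hα; omega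
    have key : X.Near α β := by
      by_contra hcon
      have hαc : α ≠ c ∧ X.oneSkeleton.Adj α c := by
        rcases hαc with h | h
        · exact absurd (h ▸ hβc.symm) hcon
        · exact ⟨h.ne, h⟩
      have hβc : β ≠ c ∧ X.oneSkeleton.Adj β c := by
        rcases hβc with h | h
        · exact absurd (h ▸ Or.inr hαc.2) hcon
        · exact ⟨h.ne, h⟩
      have nαb : ¬ X.oneSkeleton.Adj α b := fun h =>
        hcon (hX.near_of_closer hx hb ⟨hα, h⟩ ⟨hβ, hβb⟩)
      have nβa : ¬ X.oneSkeleton.Adj a β := fun h =>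
        hcon (hX.near_of_closer hx ha ⟨hα, hαa⟩ ⟨hβ, h.symm⟩)
      -- Being least, `α` and `β` precede `c` on their sphere, so by induction the parent `γ` of `c`
      -- is adjacent to both. The cycle `a, α, γ, β, b` around `c` then has no diagonal.
      have rα := SimpleGraph.lt_of_not_lt_of_ne (SimpleGraph.not_lt_parent ha ⟨hc, hca⟩) hαc.1
      have rβ := SimpleGraph.lt_of_not_lt_of_ne (SimpleGraph.not_lt_parent hb ⟨hc, hcb⟩) hβc.1
      have hγα := (ih hα hc hαc.2).2 rα
      have hγβ := (ih hβ hc hβc.2).2 rβ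
      obtain ⟨m, rfl⟩ : ∃ m, n = m + 1 := by
        refine Nat.exists_eq_succ_of_ne_zero fun h => hαc.1 ?_
        subst h
        exact (hX.eq_of_dist_eq_zero hx (adj_face_left hαa) hα).trans
          (hX.eq_of_dist_eq_zero hx (adj_face_left hca) hc).symm
      obtain ⟨hγ, hγc⟩ := hX.parent_spec hx hc
      set γ := X.oneSkeleton.parent x c
      have haγ : a ≠ γ := fun h => by rw [← h] at hγ; omega
      have hbγ : γ ≠ b := fun h => by rw [h] at hγ; omega
      have naγ : ¬ X.oneSkeleton.Adj a γ := fun h => by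
        have := SimpleGraph.dist_le_of_adj (x := x) h.symm
        omega
      have nbγ : ¬ X.oneSkeleton.Adj γ b := fun h => by
        have := SimpleGraph.dist_le_of_adj (x := x) h
        omega
      rcases hG.five c a α γ β b hca hαc.2.symm hγc.symm hβc.2.symm hcb hαa.symm hγα.symm hγβ hβb
        hab.symm haγ haβ (fun h => hcon (Or.inl h)) hαb hbγ with h | h | h | h | h
      exacts [naγ h, nβa h, hcon (Or.inr h), nαb h, nbγ h]
    refine ⟨key, fun hr => ?_⟩
    rcases SimpleGraph.parent_lt_or_eq ha hb hr with hr | he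
    · have nαb : ¬ X.oneSkeleton.Adj α b := fun h =>
        SimpleGraph.not_lt_parent hb ⟨hα, h⟩ hr
      rcases hβc with rfl | hβc
      · exact hca
      rcases hαc with rfl | hαc
      · exact absurd hcb nαb
      have hαβ := key.resolve_left fun h => nαb (h ▸ hβb)
      -- The diagonal from `α` to `b` is excluded because `α` precedes the least closer neighbour
      -- `β` of `b`.
      rcases hG.four c a α β b hca hαc.symm hβc.symm hcb hαa.symm hαβ hβb hab.symm haβ hαb
        with h | h
      exacts [h.symm, absurd h nαb]
    · have he : α = β := he
      exact he ▸ hαa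

include hX hx in
theorem parent_self : X.oneSkeleton.parent x x = x := by
  rw [SimpleGraph.parent, SimpleGraph.leastNeighbor]
  split_ifs with h
  · obtain ⟨c, hc⟩ := h
    refine absurd hc.2.ne (not_not.2 (hX.eq_of_dist_eq_zero hx (adj_face_left hc.2) ?_))
    rw [hc.1, SimpleGraph.dist_self]
  · rfl

include hX hx in
theorem near_parent_self {a : V} (ha : {a} ∈ X.faces) : X.Near (X.oneSkeleton.parent x a) a := by
  cases h : X.oneSkeleton.dist x a with
  | zero =>
    obtain rfl := hX.eq_of_dist_eq_zero hx ha h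
    exact Or.inl (hX.parent_self hx)
  | succ n => exact Or.inr (hX.parent_spec hx h).2

include hX hx in
theorem parent_mem_faces {a : V} (ha : {a} ∈ X.faces) : {X.oneSkeleton.parent x a} ∈ X.faces := by
  rcases hX.near_parent_self hx ha with h | h
  · rwa [h]
  · exact adj_face_left h

include hX hx in
theorem near_parent_of_lt {a b : V} (hab : X.oneSkeleton.Adj a b)
    (h : X.oneSkeleton.dist x a < X.oneSkeleton.dist x b ∨
      X.oneSkeleton.dist x a = X.oneSkeleton.dist x b ∧
        (X.oneSkeleton.sphereOrder x (X.oneSkeleton.dist x a)).1 a b) :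
    X.Near a (X.oneSkeleton.parent x b) := by
  rcases h with h | ⟨h, hr⟩
  · have hb : X.oneSkeleton.dist x b = X.oneSkeleton.dist x a + 1 := by
      have := SimpleGraph.dist_le_of_adj (x := x) hab
      omega
    exact hX.near_of_closer hx hb ⟨rfl, hab⟩ (hX.parent_spec hx hb)
  · exact Or.inr ((hX.parent_sphere hx rfl h.symm hab).2 hr).symm

include hX hx in
-- If `b` is one step farther than `a`, its parent equals `a` or precedes `a` on the same sphere; in
-- the second case the order statement of `parent_sphere` applies to that pair.
theorem near_parent_parent {a b : V} (hab : X.oneSkeleton.Adj a b) :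
    X.Near (X.oneSkeleton.parent x a) (X.oneSkeleton.parent x b) := by
  wlog hle : X.oneSkeleton.dist x a ≤ X.oneSkeleton.dist x b generalizing a b
  · exact (this hab.symm (by omega)).symm
  rcases hle.eq_or_lt with h | h
  · exact (hX.parent_sphere hx rfl h.symm hab).1
  have hb : X.oneSkeleton.dist x b = X.oneSkeleton.dist x a + 1 := by
    have := SimpleGraph.dist_le_of_adj (x := x) hab
    omega
  have hpb := hX.parent_spec hx hb
  rcases hX.near_of_closer hx hb ⟨rfl, hab⟩ hpb with he | hadj
  · rw [← he]
    exact hX.near_parent_self hx (adj_face_left hab)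
  · have hr := SimpleGraph.lt_of_not_lt_of_ne (SimpleGraph.not_lt_parent hb ⟨rfl, hab⟩) hadj.ne'
    exact Or.inr ((hX.parent_sphere hx hpb.1 rfl hadj.symm).2 hr)

end IsSystolic

end PreAbstractSimplicialComplex

/-! ### Moving barycentric mass from the top downwards. -/

section Slide

variable {V : Type v} [LinearOrder V]

namespace Finsupp

/-- The total mass strictly above `w`. -/
def massAbove (p : V →₀ ℝ) (w : V) : ℝ := p.sum fun a t => if w < a then t else 0

/-- The part of the mass at `w` which belongs to the uppermost mass `s` of `p`. -/
def topPart (s : ℝ) (p : V →₀ ℝ) (w : V) : ℝ := max 0 (min (p w) (s - p.massAbove w))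

/-- The uppermost mass `s` of `p` is moved along `f`. -/
def slide (f : V → V) (s : ℝ) (p : V →₀ ℝ) : V →₀ ℝ :=
  p.sum fun w t => single w (t - topPart s p w) + single (f w) (topPart s p w)

variable {f : V → V} {s : ℝ} {p : V →₀ ℝ}

theorem massAbove_eq {σ : Finset V} (h : p.support ⊆ σ) (w : V) :
    p.massAbove w = ∑ a ∈ σ, if w < a then p a else 0 :=
  Finsupp.sum_of_support_subset _ h _ fun _ _ => by simp

theorem massAbove_nonneg (hp : ∀ a, 0 ≤ p a) (w : V) : 0 ≤ p.massAbove w :=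
  Finset.sum_nonneg fun a _ => by
    dsimp only
    split_ifs
    exacts [hp a, le_rfl]

theorem topPart_nonneg (w : V) : 0 ≤ topPart s p w := le_max_left _ _

theorem topPart_le (hp : ∀ a, 0 ≤ p a) (w : V) : topPart s p w ≤ p w :=
  max_le (hp w) (min_le_left _ _)

theorem topPart_eq_zero {w : V} (h : p w = 0) : topPart s p w = 0 := by
  rw [topPart, h]
  exact max_eq_left (min_le_left _ _)

theorem massAbove_add_le (hp : ∀ a, 0 ≤ p a) {w w' : V} (h : w' < w) :
    p.massAbove w + p w ≤ p.massAbove w' := by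
  have hsub : p.support ⊆ insert w p.support := Finset.subset_insert _ _
  have h1 : p w = ∑ a ∈ insert w p.support, if a = w then p a else 0 := by
    rw [Finset.sum_ite_eq' (insert w p.support) w fun a => p a, if_pos (Finset.mem_insert_self _ _)]
  rw [massAbove_eq hsub, massAbove_eq hsub, h1, ← Finset.sum_add_distrib]
  refine Finset.sum_le_sum fun a _ => ?_
  by_cases h2 : w < a
  · rw [if_pos h2, if_pos (h.trans h2), if_neg h2.ne', add_zero]
  · rw [if_neg h2, zero_add]
    by_cases h3 : a = w
    · rw [if_pos h3, if_pos (h3 ▸ h)]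
    · rw [if_neg h3]
      split_ifs
      exacts [hp a, le_rfl]

theorem massAbove_add_le_sum (hp : ∀ a, 0 ≤ p a) (w : V) :
    p.massAbove w + p w ≤ p.sum fun _ t => t := by
  have hsub : p.support ⊆ insert w p.support := Finset.subset_insert _ _
  have h1 : p w = ∑ a ∈ insert w p.support, if a = w then p a else 0 := by
    rw [Finset.sum_ite_eq' (insert w p.support) w fun a => p a, if_pos (Finset.mem_insert_self _ _)]
  rw [massAbove_eq hsub, h1, ← Finset.sum_add_distrib,
    Finsupp.sum_of_support_subset _ hsub _ fun _ _ => rfl]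
  refine Finset.sum_le_sum fun a _ => ?_
  by_cases h2 : w < a
  · rw [if_pos h2, if_neg h2.ne', add_zero]
  · rw [if_neg h2, zero_add]
    split_ifs
    exacts [le_rfl, hp a]

/-- Mass that moves lies above mass that stays. -/
theorem le_of_topPart (hp : ∀ a, 0 ≤ p a) {w w' : V} (hw : topPart s p w < p w)
    (hw' : 0 < topPart s p w') : w ≤ w' := by
  by_contra! h
  have h1 := massAbove_add_le hp h
  have h2 : 0 < s - p.massAbove w' :=
    ((lt_max_iff.1 hw').resolve_left (lt_irrefl _)).trans_le (min_le_right _ _)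
  have h3 : s - p.massAbove w < p w :=
    (min_lt_iff.1 ((le_max_right _ _).trans_lt hw)).resolve_left (lt_irrefl _)
  linarith

theorem slide_eq {σ : Finset V} (h : p.support ⊆ σ) :
    slide f s p = ∑ w ∈ σ, (single w (p w - topPart s p w) + single (f w) (topPart s p w)) := by
  refine Finset.sum_subset h fun w _ hw => ?_
  have h0 := Finsupp.notMem_support_iff.1 hw
  simp [topPart_eq_zero h0, h0]

theorem slide_apply {σ : Finset V} (h : p.support ⊆ σ) (z : V) :
    slide f s p z = ∑ w ∈ σ, ((if w = z then p w - topPart s p w else 0) +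
      if f w = z then topPart s p w else 0) := by
  rw [slide_eq h, Finsupp.finsetSum_apply]
  exact Finset.sum_congr rfl fun w _ => by
    rw [Finsupp.add_apply, Finsupp.single_apply, Finsupp.single_apply]

theorem sum_slide : ((slide f s p).sum fun _ t => t) = p.sum fun _ t => t := by
  rw [slide_eq (Finset.Subset.refl _), ← Finsupp.sum_finsetSum_index (fun _ => rfl)
    (fun _ _ _ => rfl), Finsupp.sum]
  refine Finset.sum_congr rfl fun w _ => ?_
  rw [Finsupp.sum_add_index' (fun _ => rfl) (fun _ _ _ => rfl), Finsupp.sum_single_index rfl,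
    Finsupp.sum_single_index rfl, sub_add_cancel]

theorem slide_nonneg (hp : ∀ a, 0 ≤ p a) (z : V) : 0 ≤ slide f s p z := by
  rw [slide_apply (Finset.Subset.refl _)]
  refine Finset.sum_nonneg fun w _ => add_nonneg ?_ ?_ <;> split_ifs
  exacts [sub_nonneg.2 (topPart_le hp w), le_rfl, topPart_nonneg w, le_rfl]

/-- A vertex carries mass after the slide only if it keeps some of its own or receives some that
moved. -/
theorem support_slide (hp : ∀ a, 0 ≤ p a) : (slide f s p).support ⊆
    p.support.filter (fun w => topPart s p w < p w) ∪
      (p.support.filter fun w => 0 < topPart s p w).image f := by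
  intro z hz
  by_contra hcon
  rw [Finset.mem_union, not_or, Finset.mem_filter, Finset.mem_image] at hcon
  refine Finsupp.mem_support_iff.1 hz ?_
  rw [slide_apply (Finset.Subset.refl _)]
  refine Finset.sum_eq_zero fun w hw => ?_
  have h1 : (if w = z then p w - topPart s p w else 0) = 0 := by
    split_ifs with h
    · subst h
      exact sub_eq_zero.2 (le_antisymm (not_lt.1 fun h' => hcon.1 ⟨hw, h'⟩) (topPart_le hp w))
    · rfl
  have h2 : (if f w = z then topPart s p w else 0) = 0 := by
    split_ifs with h
    · exact le_antisymm (not_lt.1 fun h' => hcon.2 ⟨w, Finset.mem_filter.2 ⟨hw, h'⟩, h⟩)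
        (topPart_nonneg w)
    · rfl
  rw [h1, h2, add_zero]

theorem slide_of_nonpos (hp : ∀ a, 0 ≤ p a) (hs : s ≤ 0) : slide f s p = p := by
  have h : ∀ w, topPart s p w = 0 := fun w => by
    have := massAbove_nonneg hp w
    exact max_eq_left ((min_le_right _ _).trans (by linarith))
  simp only [slide, h, sub_zero, single_zero, add_zero]
  exact Finsupp.sum_single p

theorem slide_of_fixed (h : ∀ a ∈ p.support, f a = a) : slide f s p = p := by
  refine Eq.trans ?_ (Finsupp.sum_single p)
  refine Finset.sum_congr rfl fun w hw => ?_
  dsimp only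
  rw [h w hw, ← Finsupp.single_add, sub_add_cancel]

theorem support_slide_of_one_le (hp : ∀ a, 0 ≤ p a) (h1 : (p.sum fun _ t => t) = 1)
    (hs : 1 ≤ s) : (slide f s p).support ⊆ p.support.image f := by
  refine (support_slide hp).trans (Finset.union_subset (fun w hw => ?_)
    (Finset.image_subset_image (Finset.filter_subset _ _)))
  have := massAbove_add_le_sum hp w
  refine absurd (Finset.mem_filter.1 hw).2 (not_lt.2 ?_)
  exact (le_min le_rfl (by linarith)).trans (le_max_right _ _)

end Finsupp

end Slide

namespace PreAbstractSimplicialComplex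

/-! ### The contraction as an infinite composition of slides. -/

section Contraction

variable {V : Type v} {X : PreAbstractSimplicialComplex V}

/-- To be continuous on the product of a locally compact space with the realization, it suffices to
be so over each closed simplex. -/
theorem continuous_prod_realization {T Y : Type*} [TopologicalSpace T] [LocallyCompactSpace T]
    [TopologicalSpace Y] {g : T × X.Realization → Y}
    (h : ∀ σ ∈ X.faces, Continuous fun q : T × X.FaceSpace σ => g (q.1, q.2.incl)) :
    Continuous g := by
  have hslice : ∀ p : X.Realization, Continuous fun t => g (t, p) := fun p =>
    let p' : X.FaceSpace p.1.support := ⟨p, Finset.Subset.refl _⟩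
    have hp' : Continuous fun t : T => (t, p') := continuous_id.prodMk continuous_const
    (h _ p.2.1).comp hp'
  -- Currying turns the claim into continuity on the realization alone; uncurrying back uses local
  -- compactness of `T`.
  let k : X.Realization → C(T, Y) := fun p => ⟨fun t => g (t, p), hslice p⟩
  have hk : Continuous k := realization_continuous_iff.2 fun σ hσ => by
    let m : C(X.FaceSpace σ × T, Y) := ⟨fun q => g (q.2, q.1.incl), (h σ hσ).comp continuous_swap⟩
    exact m.curry.continuous
  exact (ContinuousMap.continuous_uncurry_of_continuous ⟨k, hk⟩).comp continuous_swap

/-- A vertex map `f` moving vertices down to a base vertex `x`, such that in each simplex the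
vertices can be moved one by one in decreasing order. -/
structure IsContraction [LinearOrder V] (X : PreAbstractSimplicialComplex V) (x : V) (ℓ : V → ℕ)
    (f : V → V) : Prop where
  flag : X.IsFlag
  map_vertex : ∀ a, {a} ∈ X.faces → {f a} ∈ X.faces
  near_of_le : ∀ a b, {a} ∈ X.faces → {b} ∈ X.faces → X.Near a b → a ≤ b → X.Near a (f b)
  near_map : ∀ a b, {a} ∈ X.faces → {b} ∈ X.faces → X.Near a b → X.Near (f a) (f b)
  level_map : ∀ a, ℓ (f a) = ℓ a - 1
  eq_base : ∀ a, {a} ∈ X.faces → ℓ a = 0 → a = x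
  map_base : f x = x

namespace IsContraction

variable [LinearOrder V] {x : V} {ℓ : V → ℕ} {f : V → V} (h : X.IsContraction x ℓ f)

include h in
-- Vertices that keep mass lie below or at those that lose it, so `near_of_le` makes them near the
-- images of the latter. With `near_map` all vertices involved are pairwise near, and flagness
-- applies.
theorem support_slide_mem (s : ℝ) (p : X.Realization) :
    (Finsupp.slide f s p.1).support ∈ X.faces := by
  have hp := p.2.2.1
  have hv : ∀ a ∈ p.1.support, {a} ∈ X.faces := fun a ha => face_singleton p.2.1 ha
  have hn : ∀ a ∈ p.1.support, ∀ b ∈ p.1.support, X.Near a b := fun a ha b hb =>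
    or_iff_not_imp_left.2 fun hab => adj_of_mem_face p.2.1 ha hb hab
  have hne : (Finsupp.slide f s p.1).support.Nonempty :=
    support_nonempty_of_sum (Finsupp.sum_slide.trans p.2.2.2)
  have hsub := Finsupp.support_slide (f := f) (s := s) hp
  refine face_mono (h.flag.mem_of_near (hne.mono hsub) (fun a ha => ?_) fun a ha b hb => ?_) hsub hne
  · rw [Finset.mem_union, Finset.mem_filter, Finset.mem_image] at ha
    rcases ha with ha | ⟨c, hc, rfl⟩
    · exact hv a ha.1
    · exact h.map_vertex c (hv c (Finset.mem_filter.1 hc).1)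
  · have key : ∀ a ∈ p.1.support.filter (fun w => Finsupp.topPart s p.1 w < p.1 w),
        ∀ b ∈ p.1.support.filter (fun w => 0 < Finsupp.topPart s p.1 w), X.Near a (f b) := by
      intro a ha b hb
      rw [Finset.mem_filter] at ha hb
      exact h.near_of_le a b (hv a ha.1) (hv b hb.1) (hn a ha.1 b hb.1)
        (Finsupp.le_of_topPart hp ha.2 hb.2)
    rw [Finset.mem_union, Finset.mem_image] at ha hb
    rcases ha with ha | ⟨c, hc, rfl⟩ <;> rcases hb with hb | ⟨d, hd, rfl⟩
    · exact hn a (Finset.mem_filter.1 ha).1 b (Finset.mem_filter.1 hb).1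
    · exact key a ha d hd
    · exact (key b hb c hc).symm
    · rw [Finset.mem_filter] at hc hd
      exact h.near_map c d (hv c hc.1) (hv d hd.1) (hn c hc.1 d hd.1)

/-- The homotopy moving the mass of a point along `f`, uppermost mass first. -/
def slide (s : ℝ) (p : X.Realization) : X.Realization :=
  ⟨Finsupp.slide f s p.1, h.support_slide_mem s p, Finsupp.slide_nonneg p.2.2.1,
    Finsupp.sum_slide.trans p.2.2.2⟩

theorem continuous_slide : Continuous fun q : ℝ × X.Realization => h.slide q.1 q.2 := by
  refine continuous_prod_realization fun σ _ => ?_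
  have hc : ∀ a, Continuous fun q : ℝ × X.FaceSpace σ => q.2.incl.1 a := fun a =>
    (FaceSpace.continuous_coord a).comp continuous_snd
  have hm : ∀ a, Continuous fun q : ℝ × X.FaceSpace σ => Finsupp.massAbove q.2.incl.1 a := by
    intro a
    simp only [fun q : ℝ × X.FaceSpace σ => Finsupp.massAbove_eq q.2.support_subset a]
    refine continuous_finsetSum _ fun b _ => ?_
    split_ifs
    exacts [hc b, continuous_const]
  have ht : ∀ a, Continuous fun q : ℝ × X.FaceSpace σ => Finsupp.topPart q.1 q.2.incl.1 a :=
    fun a => continuous_const.max ((hc a).min (continuous_fst.sub (hm a)))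
  refine Realization.continuous_of_coord (σ ∪ σ.image f) (fun q => ?_) fun z => ?_
  · exact (Finsupp.support_slide q.2.incl.2.2.1).trans (Finset.union_subset_union
      ((Finset.filter_subset _ _).trans q.2.support_subset)
      (Finset.image_subset_image ((Finset.filter_subset _ _).trans q.2.support_subset)))
  · have : (fun q : ℝ × X.FaceSpace σ => (h.slide q.1 q.2.incl).1 z) = fun q =>
        ∑ w ∈ σ, ((if w = z then q.2.incl.1 w - Finsupp.topPart q.1 q.2.incl.1 w else 0) +
          if f w = z then Finsupp.topPart q.1 q.2.incl.1 w else 0) :=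
      funext fun q => Finsupp.slide_apply q.2.support_subset z
    rw [this]
    refine continuous_finsetSum _ fun w _ => Continuous.add ?_ ?_ <;> split_ifs
    exacts [(hc w).sub (ht w), continuous_const, ht w, continuous_const]

theorem continuous_slide_comp {T : Type*} [TopologicalSpace T] {s : T → ℝ} {g : T → X.Realization}
    (hs : Continuous s) (hg : Continuous g) : Continuous fun t => h.slide (s t) (g t) := by
  have := h.continuous_slide.comp (hs.prodMk hg)
  exact this

/-- The composition of the first `n` slides; the `n`-th one takes place while `1 - t` decreases from
`2⁻ⁿ` to `2⁻ⁿ⁻¹`. -/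
def slides (t : ℝ) (p : X.Realization) : ℕ → X.Realization
  | 0 => p
  | n + 1 => h.slide (2 - 2 ^ (n + 1) * (1 - t)) (slides t p n)

theorem continuous_slides (n : ℕ) :
    Continuous fun q : ℝ × X.Realization => h.slides q.1 q.2 n := by
  induction n with
  | zero => exact continuous_snd
  | succ n ih =>
    have hs : Continuous fun q : ℝ × X.Realization => 2 - 2 ^ (n + 1) * (1 - q.1) :=
      continuous_const.sub (continuous_const.mul (continuous_const.sub continuous_fst))
    exact h.continuous_slide_comp hs ih

theorem slides_zero_left (p : X.Realization) (n : ℕ) : h.slides 0 p n = p := by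
  induction n with
  | zero => rfl
  | succ n ih =>
    rw [slides, ih]
    refine Subtype.ext (Finsupp.slide_of_nonpos p.2.2.1 ?_)
    have : (1 : ℝ) ≤ 2 ^ n := one_le_pow₀ one_le_two
    rw [pow_succ]
    linarith

/-- At time `t` the first `n` slides are complete, and each complete slide pushes the support
through `f`, lowering levels by one. -/
theorem level_slides {t : ℝ} {n N : ℕ} (ht : 2 ^ n * (1 - t) ≤ 1) (h1 : t ≤ 1)
    {p : X.Realization} (hp : ∀ a ∈ p.1.support, ℓ a ≤ N) (k : ℕ) (hk : k ≤ n) :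
    ∀ a ∈ (h.slides t p k).1.support, ℓ a ≤ N - k := by
  induction k with
  | zero => exact hp
  | succ k ih =>
    intro a ha
    have hs : (1 : ℝ) ≤ 2 - 2 ^ (k + 1) * (1 - t) := by
      have h2 : (2 : ℝ) ^ (k + 1) * (1 - t) ≤ 2 ^ n * (1 - t) :=
        mul_le_mul_of_nonneg_right (pow_le_pow_right₀ one_le_two hk) (sub_nonneg.2 h1)
      linarith
    obtain ⟨b, hb, rfl⟩ := Finset.mem_image.1 (Finsupp.support_slide_of_one_le
      (h.slides t p k).2.2.1 (h.slides t p k).2.2.2 hs ha)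
    have := ih (by omega) b hb
    rw [h.level_map]
    omega

theorem support_slides {t : ℝ} {n : ℕ} (ht : 2 ^ n * (1 - t) ≤ 1) (h1 : t ≤ 1)
    {p : X.Realization} (hp : ∀ a ∈ p.1.support, ℓ a ≤ n) :
    ∀ a ∈ (h.slides t p n).1.support, a = x := fun a ha => by
  have := h.level_slides ht h1 hp n le_rfl a ha
  exact h.eq_base a (face_singleton (h.slides t p n).2.1 ha) (by omega)

/-- Either the first `n` slides are complete, so that all mass sits at the fixed vertex `x`, or the
next slide has not begun. -/
theorem slides_succ {t : ℝ} {n : ℕ} (h1 : t ≤ 1) {p : X.Realization}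
    (hp : ∀ a ∈ p.1.support, ℓ a ≤ n) : h.slides t p (n + 1) = h.slides t p n := by
  rcases le_total (2 ^ n * (1 - t)) 1 with ht | ht
  · refine Subtype.ext (Finsupp.slide_of_fixed fun a ha => ?_)
    rw [h.support_slides ht h1 hp a ha, h.map_base]
  · refine Subtype.ext (Finsupp.slide_of_nonpos (h.slides t p n).2.2.1 ?_)
    rw [pow_succ]
    linarith

theorem slides_of_le {t : ℝ} {n m : ℕ} (h1 : t ≤ 1) {p : X.Realization}
    (hp : ∀ a ∈ p.1.support, ℓ a ≤ n) (hnm : n ≤ m) : h.slides t p m = h.slides t p n := by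
  induction m, hnm using Nat.le_induction with
  | base => rfl
  | succ m hm ih =>
    rw [← ih]
    exact h.slides_succ h1 fun a ha => (hp a ha).trans hm

include h in
theorem contractibleSpace (hx : {x} ∈ X.faces) : ContractibleSpace X.Realization := by
  let N : Finset V → ℕ := fun σ => σ.sup ℓ
  have hN : ∀ σ : Finset V, ∀ a ∈ σ, ℓ a ≤ N σ := fun σ a ha => Finset.le_sup ha
  -- The number of slides depends on the point, but over the closed simplex of `σ` it may be
  -- replaced by the constant `N σ`, since further slides change nothing.
  let K : unitInterval × X.Realization → X.Realization := fun q =>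
    h.slides q.1 q.2 (N q.2.1.support)
  have hK : Continuous K := by
    refine continuous_prod_realization fun σ _ => ?_
    have : (fun q : unitInterval × X.FaceSpace σ => K (q.1, q.2.incl)) =
        fun q => h.slides q.1 q.2.incl (N σ) :=
      funext fun q => (h.slides_of_le q.1.2.2 (hN _) (Finset.sup_mono q.2.support_subset)).symm
    rw [this]
    have hi : Continuous fun q : unitInterval × X.FaceSpace σ => ((q.1 : ℝ), q.2.incl) :=
      (continuous_subtype_val.comp continuous_fst).prodMk
        ((FaceSpace.continuous_incl ‹_›).comp continuous_snd)
    exact (h.continuous_slides (N σ)).comp hi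
  rw [contractible_iff_id_nullhomotopic]
  refine ⟨Realization.vertex hx, ⟨⟨⟨K, hK⟩, fun p => h.slides_zero_left p _, fun p => ?_⟩⟩⟩
  have hs := h.support_slides (t := 1) (n := N p.1.support) (by norm_num) le_rfl (hN p.1.support)
  change h.slides 1 p (N p.1.support) = Realization.vertex hx
  set q := h.slides 1 p (N p.1.support)
  have hq := q.sum_eq_one (σ := {x}) fun a ha => Finset.mem_singleton.2 (hs a ha)
  rw [Finset.sum_singleton] at hq
  refine Realization.ext fun a => ?_
  change q.1 a = Finsupp.single x (1 : ℝ) a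
  by_cases hax : a = x
  · rw [hax, Finsupp.single_eq_same, hq]
  · rw [Finsupp.single_eq_of_ne hax]
    exact Finsupp.notMem_support_iff.1 fun ha => hax (hs a ha)

end IsContraction

/-- Systolic complexes are contractible. -/
theorem IsSystolic.contractibleSpace (hX : X.IsSystolic) : ContractibleSpace X.Realization := by
  have := hX.1
  obtain ⟨p⟩ : Nonempty X.Realization := inferInstance
  obtain ⟨x, hxp⟩ := face_nonempty p.2.1
  have hx : {x} ∈ X.faces := face_singleton p.2.1 hxp
  obtain ⟨L, hL⟩ := SimpleGraph.exists_linearOrder X.oneSkeleton x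
  refine IsContraction.contractibleSpace (x := x) (ℓ := X.oneSkeleton.dist x)
    (f := X.oneSkeleton.parent x) ⟨hX.2.1, fun a ha => hX.parent_mem_faces hx ha, ?_, ?_,
      fun a => hX.dist_parent hx a, fun a ha h => hX.eq_of_dist_eq_zero hx ha h,
      hX.parent_self hx⟩ hx
  · intro a b _ hb hab hle
    rcases hab with rfl | hab
    · exact (hX.near_parent_self hx hb).symm
    · exact hX.near_parent_of_lt hx hab (hL a b (lt_of_le_of_ne hle hab.ne))
  · intro a b _ _ hab
    rcases hab with rfl | hab
    · exact Or.inl rfl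
    · exact hX.near_parent_parent hx hab

end Contraction

end PreAbstractSimplicialComplex

end

theorem mainTheorem3 :
    (∀ (V : Type v) (X : PreAbstractSimplicialComplex V),
      X.IsSystolic → X.NoInfiniteClique → X.IsWeaklySystolic) ∧
    (∀ (G : Type u) [Group G],
      IsSystolicGroup.{u, v} G → IsWeaklySystolicGroup.{u, v} G) ∧
    (∀ (V : Type v) (X : PreAbstractSimplicialComplex V),
      X.IsSystolic → X.IsFiniteDimensional → ContractibleSpace X.Realization) := by
  refine ⟨fun V X hX h => hX.isWeaklySystolic h, ?_, fun V X hX _ => hX.contractibleSpace⟩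
  rintro G _ ⟨V, X, φ, hX, hφ⟩
  exact ⟨V, X, φ, hX.isWeaklySystolic (hX.2.1.noInfiniteClique hφ.isFiniteDimensional), hφ⟩
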